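/- Let $L\ge 1$ and let the sites $x=1,\dots,L$ form a ring (addition of sites is modulo $L$). On $\mathcal H_L=\bigotimes_{x=1}^L\mathbb C^2$, where $\mathbb C^2$ has the orthonormal basis $|0\rangle,|1\rangle$, let $\sigma_x^-$ be the operator acting at site $x$ by $|1\rangle\mapsto|0\rangle$, $|0\rangle\mapsto 0$, and let $n_x=(\sigma_x^-)^*\sigma_x^-$. For $\lambda\in\mathbb C$ and $\kappa\ge 0$ put $$q_x=\sigma^-_{x+1}\sigma^-_{x+2}-\lambda\,\sigma^-_x\sigma^-_{x+3},\qquad H^{\mathrm{per}}_{\Lambda_L}=\sum_{x=1}^L\bigl(n_xn_{x+2}+\kappa\,q_x^*q_x\bigr),$$ the periodic truncated $\nu=1/3$ Haldane spin chain, and let $\operatorname{gap}(H)$ denote the distance from the lowest eigenvalue of $H$ to the rest of its spectrum. For $r\ge0$ let $\beta_\pm=\tfrac12(1\pm\sqrt{1+4r})$, $\beta=\beta_- /\beta_+$, $\beta_k=\beta_k(r)=\frac1{\beta_+}\frac{1-\beta^k}{1-\beta^{k+1}}$ for $k\ge1$, and for $k\ge4$ $$f_k(r)=r\,\beta_k\beta_{k-2}\left(\frac{[1-\beta_{k-1}(1+r)]^2}{1+2r}+\beta_{k-3}\frac{r(1-\beta_{k-1})^2}{1+r}\right).$$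 **Theorem.** The supremum $f(r)=\sup_{k\ge4}f_k(r)$ is finite for every $r\ge0$, and it defines a monotone increasing function $f:[0,\infty)\to[0,\infty)$ with the following properties. 1. For all $\lambda\in\mathbb C$ with $\lambda\ne0$ and $f(|\lambda|^2)<1/3$ and all $\kappa\ge0$, $$\liminf_{L\to\infty}\operatorname{gap}(H^{\mathrm{per}}_{\Lambda_L})\ \ge\ b(\kappa,\lambda):=\min\left\{\gamma^{\mathrm{per}},\ \frac{\kappa}{6(1+2|\lambda|^2)}\Bigl(1-\sqrt{3f(|\lambda|^2)}\Bigr)^2\right\},$$ where $$\gamma^{\mathrm{per}}=\frac13\min\left\{1,\ \frac{\kappa}{2+2\kappa|\lambda|^2},\ \frac{\kappa}{1+\kappa}\right\}.$$ 2. The bound stays positive as $\lambda\to0$: one has $f(|\lambda|^2)<1/3$ for all sufficiently small $\lambda\neq 0$, and for every $\kappa>0$ $$\lim_{\lambda\to0,\ \lambda\ne0}b(\kappa,\lambda)=\frac13\min\left\{1,\frac\kappa2,\frac{\kappa}{1+\kappa}\right\}>0.$$ -/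

import Mathlib

open scoped Topology NNReal

namespace Haldane

/-- Occupation configurations of the ring of `L` sites. They label the orthonormal occupation basis
`|μ⟩` of the `L`-fold tensor product of `ℂ²`; operators on that Hilbert space are written as
matrices in this basis. Sites are numbered `0, …, L - 1`. -/
abbrev Config (L : ℕ) : Type := Fin L → Fin 2

/-- The site `x + d` of the ring, addition being modulo `L`. -/
def ringShift {L : ℕ} (x : Fin L) (d : ℕ) : Fin L :=
  ⟨(x.val + d) % L, Nat.mod_lt _ x.pos⟩

/-- The operator `1 ⊗ ⋯ ⊗ a ⊗ ⋯ ⊗ 1` in which the `2 × 2` matrix `a` acts on the factor at the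
site `x`. -/
def siteOp {L : ℕ} (x : Fin L) (a : Matrix (Fin 2) (Fin 2) ℂ) :
    Matrix (Config L) (Config L) ℂ :=
  Matrix.of fun μ ν => if ∀ y, y ≠ x → μ y = ν y then a (μ x) (ν x) else 0

/-- The spin lowering operator at the site `x`: it sends `|1⟩` to `|0⟩` and kills `|0⟩`
(rows and columns of the `2 × 2` matrix are indexed by the occupation number `0, 1`). -/
def lower {L : ℕ} (x : Fin L) : Matrix (Config L) (Config L) ℂ :=
  siteOp x !![0, 1; 0, 0]

/-- The occupation number operator at the site `x` (raising after lowering). -/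
def number {L : ℕ} (x : Fin L) : Matrix (Config L) (Config L) ℂ :=
  (lower x).conjTranspose * lower x

/-- The dipole operator `q_x = σ⁻_{x+1} σ⁻_{x+2} - lam σ⁻_x σ⁻_{x+3}` on the ring. -/
def dipole {L : ℕ} (lam : ℂ) (x : Fin L) : Matrix (Config L) (Config L) ℂ :=
  lower (ringShift x 1) * lower (ringShift x 2) - lam • (lower x * lower (ringShift x 3))

/-- The spin chain `∑_x (n_x n_{x+2} + κ q_x^* q_x)` on the ring of `L` sites. -/
noncomputable def periodicHamiltonian (L : ℕ) (κ : ℝ) (lam : ℂ) :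
    Matrix (Config L) (Config L) ℂ :=
  ∑ x : Fin L, (number x * number (ringShift x 2) +
    (κ : ℂ) • ((dipole lam x).conjTranspose * dipole lam x))

/-- The lowest point of the (real) spectrum. -/
noncomputable def groundEnergy {ι : Type*} [Fintype ι] [DecidableEq ι] (H : Matrix ι ι ℂ) : ℝ :=
  sInf (spectrum ℝ H)

/-- The spectral gap: the distance from the ground state energy to the rest of the spectrum. -/
noncomputable def spectralGap {ι : Type*} [Fintype ι] [DecidableEq ι] (H : Matrix ι ι ℂ) : ℝ :=
  sInf {δ : ℝ | 0 < δ ∧ groundEnergy H + δ ∈ spectrum ℝ H}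

/-- `β₊ = (1 + √(1 + 4 r)) / 2`. -/
noncomputable def betaPlus (r : ℝ) : ℝ := (1 + √(1 + 4 * r)) / 2

/-- `β₋ = (1 - √(1 + 4 r)) / 2`. -/
noncomputable def betaMinus (r : ℝ) : ℝ := (1 - √(1 + 4 * r)) / 2

/-- `β_n = (1 / β₊) (1 - β ^ n) / (1 - β ^ (n + 1))` with `β = β₋ / β₊`. -/
noncomputable def betaSeq (n : ℕ) (r : ℝ) : ℝ :=
  1 / betaPlus r * ((1 - (betaMinus r / betaPlus r) ^ n) /
    (1 - (betaMinus r / betaPlus r) ^ (n + 1)))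

/-- The functions `f_k`, used only for `k ≥ 4`. -/
noncomputable def fSeq (k : ℕ) (r : ℝ) : ℝ :=
  r * betaSeq k r * betaSeq (k - 2) r *
    ((1 - betaSeq (k - 1) r * (1 + r)) ^ 2 / (1 + 2 * r) +
      betaSeq (k - 3) r * (r * (1 - betaSeq (k - 1) r) ^ 2 / (1 + r)))

/-- `γ^per = (1/3) min {1, κ / (2 + 2 κ |lam|²), κ / (1 + κ)}`. -/
noncomputable def gammaPer (κ : ℝ) (lam : ℂ) : ℝ :=
  1 / 3 * min 1 (min (κ / (2 + 2 * κ * ‖lam‖ ^ 2)) (κ / (1 + κ)))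

/-- The lower bound on the bulk gap, as a function of the value `v` of `f` at `|lam|²`:
`min {γ^per, κ / (6 (1 + 2 |lam|²)) (1 - √(3 v))²}`. -/
noncomputable def gapBound (κ : ℝ) (lam : ℂ) (v : ℝ) : ℝ :=
  min (gammaPer κ lam) (κ / (6 * (1 + 2 * ‖lam‖ ^ 2)) * (1 - √(3 * v)) ^ 2)

end Haldane


/-!
The configurations read off from tilings of the ring by voids, monomers and dimers span an invariant
subspace of the Hamiltonian, and so do the remaining configurations.

On the tilings the electrostatic energy vanishes. After conjugation by `λ ^ (number of dimers)` the
Hamiltonian is there `κ` times the negative generator of a jump process in which dimers decay at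
rate `1` and pairs of monomers recombine at rate `|λ|²`. The increments of an eigenfunction along
the decays satisfy a closed equation of their own, and a maximum principle for them, with the
weight of a dimer lowered when it has a vacant neighbour, shows that a nonzero eigenvalue is at
least `κ / (1 + |λ|²)`.

A configuration that is not a tiling contains one of four forbidden patterns. Either two of its
particles are at distance two, or moving one or two dimers brings this about, so that the
Cauchy–Schwarz inequality bounds its squared amplitude by the energy. Summation over all
configurations gives the lower bound `1 / (2 + 4 / κ + 2 |λ|²)` on the eigenvalues.
-/

namespace Haldane

theorem one_le_betaPlus {r : ℝ} (hr : 0 ≤ r) : 1 ≤ betaPlus r := by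
  have : 1 ≤ √(1 + 4 * r) := Real.one_le_sqrt.2 (by linarith)
  unfold betaPlus; linarith

theorem betaRatio_mem {r : ℝ} (hr : 0 ≤ r) :
    -1 < betaMinus r / betaPlus r ∧ betaMinus r / betaPlus r ≤ 0 := by
  have hsqrt : 1 ≤ √(1 + 4 * r) := Real.one_le_sqrt.2 (by linarith)
  have hplus := one_le_betaPlus hr
  constructor
  · rw [lt_div_iff₀ (by linarith)]
    unfold betaPlus betaMinus; linarith
  · exact div_nonpos_of_nonpos_of_nonneg (by unfold betaMinus; linarith) (by linarith)

theorem betaPlus_mul_one_add_ratio {r : ℝ} (hr : 0 ≤ r) :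
    betaPlus r * (1 + betaMinus r / betaPlus r) = 1 := by
  have hplus := one_le_betaPlus hr
  have : betaPlus r ≠ 0 := by linarith
  have hadd : betaPlus r + betaMinus r = 1 := by unfold betaPlus betaMinus; ring
  field_simp
  exact hadd

theorem betaPlus_sq_mul_ratio {r : ℝ} (hr : 0 ≤ r) :
    betaPlus r ^ 2 * (betaMinus r / betaPlus r) = -r := by
  have hplus := one_le_betaPlus hr
  have : betaPlus r ≠ 0 := by linarith
  have hmul : betaPlus r * betaMinus r = -r := by
    have := Real.sq_sqrt (show 0 ≤ 1 + 4 * r by linarith)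
    unfold betaPlus betaMinus; linarith
  field_simp
  exact hmul

theorem betaSeq_zero (r : ℝ) : betaSeq 0 r = 0 := by simp [betaSeq]

theorem betaSeq_succ_mul (n : ℕ) {r : ℝ} (hr : 0 ≤ r) :
    betaSeq (n + 1) r * (1 + r * betaSeq n r) = 1 := by
  obtain ⟨hratio_gt, hratio_le⟩ := betaRatio_mem hr
  have hadd := betaPlus_mul_one_add_ratio hr
  have hsq := betaPlus_sq_mul_ratio hr
  have hplus := one_le_betaPlus hr
  unfold betaSeq
  generalize betaMinus r / betaPlus r = β at *
  generalize betaPlus r = p at *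
  have hne : ∀ m : ℕ, 1 - β ^ (m + 1) ≠ 0 := fun m h => by
    have hlt : |β ^ (m + 1)| < 1 := by
      rw [abs_pow]
      exact pow_lt_one₀ (abs_nonneg _) (by rw [abs_lt]; constructor <;> linarith) (by omega)
    have := le_abs_self (β ^ (m + 1))
    linarith
  have hn := hne n
  have hn_succ := hne (n + 1)
  have hp0 : p ≠ 0 := by linarith
  have hr' : r = -(p ^ 2 * β) := by linarith
  rw [hr']
  field_simp
  linear_combination (-(1 - β ^ (n + 1))) * hadd

theorem betaSeq_nonneg (n : ℕ) {r : ℝ} (hr : 0 ≤ r) : 0 ≤ betaSeq n r := by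
  induction n with
  | zero => exact (betaSeq_zero r).ge
  | succ n ih =>
    have h := betaSeq_succ_mul n hr
    by_contra! hlt
    have : 0 < 1 + r * betaSeq n r := by positivity
    nlinarith

theorem betaSeq_succ (n : ℕ) {r : ℝ} (hr : 0 ≤ r) :
    betaSeq (n + 1) r = 1 / (1 + r * betaSeq n r) := by
  have := betaSeq_nonneg n hr
  rw [eq_div_iff (by positivity)]
  exact betaSeq_succ_mul n hr

theorem betaSeq_le_one (n : ℕ) {r : ℝ} (hr : 0 ≤ r) : betaSeq n r ≤ 1 := by
  cases n with
  | zero => simp [betaSeq_zero]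
  | succ n =>
    have := betaSeq_nonneg n hr
    rw [betaSeq_succ n hr, div_le_one (by positivity)]
    have : 0 ≤ r * betaSeq n r := by positivity
    linarith

theorem betaSeq_antitone_and_mul_monotone (n : ℕ) {r s : ℝ} (hr : 0 ≤ r) (hrs : r ≤ s) :
    betaSeq n s ≤ betaSeq n r ∧ r * betaSeq n r ≤ s * betaSeq n s := by
  have hs := hr.trans hrs
  induction n with
  | zero => simp [betaSeq_zero]
  | succ n ih =>
    have hr_nonneg := betaSeq_nonneg n hr
    have hs_nonneg := betaSeq_nonneg n hs
    rw [betaSeq_succ n hr, betaSeq_succ n hs]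
    constructor
    · exact one_div_le_one_div_of_le (by positivity) (by linarith [ih.2])
    · rw [mul_one_div, mul_one_div, div_le_div_iff₀ (by positivity) (by positivity)]
      have : r * s * betaSeq n s ≤ r * s * betaSeq n r :=
        mul_le_mul_of_nonneg_left ih.1 (by positivity)
      nlinarith

theorem betaSeq_antitone (n : ℕ) {r s : ℝ} (hr : 0 ≤ r) (hrs : r ≤ s) :
    betaSeq n s ≤ betaSeq n r :=
  (betaSeq_antitone_and_mul_monotone n hr hrs).1

theorem fSeq_eq {k : ℕ} (hk : 4 ≤ k) {r : ℝ} (hr : 0 ≤ r) :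
    fSeq k r = r / (1 + r) * (r / (1 + 2 * r)) * (1 - betaSeq (k - 2) r) *
      (1 - betaSeq (k - 1) r) := by
  obtain ⟨m, rfl⟩ := Nat.exists_eq_add_of_le' hk
  simp only [fSeq, show m + 4 - 1 = m + 3 by omega, show m + 4 - 2 = m + 2 by omega,
    show m + 4 - 3 = m + 1 by omega]
  have hb := betaSeq_nonneg (m + 1) hr
  have hsecond := betaSeq_succ (m + 1) hr
  have hthird := betaSeq_succ (m + 2) hr
  have hfourth := betaSeq_succ (m + 3) hr
  generalize betaSeq (m + 1) r = b at *
  replace hsecond : betaSeq (m + 2) r = 1 / (1 + r * b) := hsecond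
  replace hthird : betaSeq (m + 3) r = (1 + r * b) / (1 + r + r * b) := by
    rw [hthird, hsecond]; field_simp; ring
  replace hfourth : betaSeq (m + 4) r = (1 + r + r * b) / (1 + 2 * r + r * (1 + r) * b) := by
    rw [hfourth, hthird]; field_simp; ring
  rw [hfourth, hthird, hsecond]
  field_simp
  ring

theorem fSeq_nonneg {k : ℕ} (hk : 4 ≤ k) {r : ℝ} (hr : 0 ≤ r) : 0 ≤ fSeq k r := by
  have := sub_nonneg.2 (betaSeq_le_one (k - 1) hr)
  have := sub_nonneg.2 (betaSeq_le_one (k - 2) hr)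
  rw [fSeq_eq hk hr]
  positivity

theorem fSeq_mono {k : ℕ} (hk : 4 ≤ k) {r s : ℝ} (hr : 0 ≤ r) (hrs : r ≤ s) :
    fSeq k r ≤ fSeq k s := by
  have hs := hr.trans hrs
  have hr_fst := sub_nonneg.2 (betaSeq_le_one (k - 1) hr)
  have hr_snd := sub_nonneg.2 (betaSeq_le_one (k - 2) hr)
  have hs_snd := sub_nonneg.2 (betaSeq_le_one (k - 2) hs)
  have hone : r / (1 + r) ≤ s / (1 + s) := by
    rw [div_le_div_iff₀ (by positivity) (by positivity)]; nlinarith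
  have htwo : r / (1 + 2 * r) ≤ s / (1 + 2 * s) := by
    rw [div_le_div_iff₀ (by positivity) (by positivity)]; nlinarith
  rw [fSeq_eq hk hr, fSeq_eq hk hs]
  gcongr
  · exact betaSeq_antitone _ hr hrs
  · exact betaSeq_antitone _ hr hrs

theorem fSeq_le {k : ℕ} (hk : 4 ≤ k) {r : ℝ} (hr : 0 ≤ r) :
    fSeq k r ≤ r / (1 + r) * (r / (1 + 2 * r)) := by
  have := sub_nonneg.2 (betaSeq_le_one (k - 1) hr)
  have := sub_nonneg.2 (betaSeq_le_one (k - 2) hr)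
  have := betaSeq_nonneg (k - 1) hr
  have := betaSeq_nonneg (k - 2) hr
  calc fSeq k r = r / (1 + r) * (r / (1 + 2 * r)) * (1 - betaSeq (k - 2) r) *
        (1 - betaSeq (k - 1) r) := fSeq_eq hk hr
    _ ≤ r / (1 + r) * (r / (1 + 2 * r)) * 1 * 1 := by gcongr <;> linarith
    _ = r / (1 + r) * (r / (1 + 2 * r)) := by ring

/-- The function `f` of the theorem: the supremum of the `f_k` with `k ≥ 4`. -/
noncomputable def fSup (r : ℝ≥0) : ℝ≥0 :=
  ⟨sSup {y : ℝ | ∃ k : ℕ, 4 ≤ k ∧ y = fSeq k r},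
    Real.sSup_nonneg <| by rintro _ ⟨k, hk, rfl⟩; exact fSeq_nonneg hk r.2⟩

theorem isLUB_fSup (r : ℝ≥0) : IsLUB {y : ℝ | ∃ k : ℕ, 4 ≤ k ∧ y = fSeq k r} (fSup r) :=
  isLUB_csSup ⟨_, 4, le_rfl, rfl⟩ ⟨_, by rintro _ ⟨k, hk, rfl⟩; exact fSeq_le hk r.2⟩

theorem fSup_le (r : ℝ≥0) : (fSup r : ℝ) ≤ r / (1 + r) * (r / (1 + 2 * r)) :=
  (isLUB_fSup r).2 <| by rintro _ ⟨k, hk, rfl⟩; exact fSeq_le hk r.2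

theorem fSup_le_one (r : ℝ≥0) : (fSup r : ℝ) ≤ 1 := by
  have := r.coe_nonneg
  exact (fSup_le r).trans <| mul_le_one₀ (div_le_one_of_le₀ (by linarith) (by positivity))
    (by positivity) (div_le_one_of_le₀ (by linarith) (by positivity))

theorem monotone_fSup : Monotone fSup := by
  intro r s hrs
  rw [← NNReal.coe_le_coe]
  refine (isLUB_fSup r).2 ?_
  rintro _ ⟨k, hk, rfl⟩
  exact (fSeq_mono hk r.2 hrs).trans ((isLUB_fSup s).1 ⟨k, hk, rfl⟩)

theorem tendsto_norm_punctured_nhds_zero :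
    Filter.Tendsto (fun lam : ℂ => ‖lam‖) (𝓝[≠] 0) (𝓝 0) :=
  tendsto_norm_zero.mono_left nhdsWithin_le_nhds

theorem tendsto_fSup :
    Filter.Tendsto (fun lam : ℂ => (fSup (‖lam‖₊ ^ 2) : ℝ)) (𝓝[≠] 0) (𝓝 0) := by
  have hbound : Filter.Tendsto (fun lam : ℂ =>
      ‖lam‖ ^ 2 / (1 + ‖lam‖ ^ 2) * (‖lam‖ ^ 2 / (1 + 2 * ‖lam‖ ^ 2))) (𝓝[≠] 0) (𝓝 0) := by
    have hcont : Continuous fun t : ℝ => t ^ 2 / (1 + t ^ 2) * (t ^ 2 / (1 + 2 * t ^ 2)) := by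
      fun_prop (disch := intro t; positivity)
    simpa [Function.comp_def] using (hcont.tendsto 0).comp tendsto_norm_punctured_nhds_zero
  refine squeeze_zero (fun _ => NNReal.coe_nonneg _) (fun lam => ?_) hbound
  rw [← coe_nnnorm, ← NNReal.coe_pow]
  exact fSup_le _

theorem tendsto_gapBound {κ : ℝ} (hκ : 0 < κ) :
    Filter.Tendsto (fun lam : ℂ => gapBound κ lam (fSup (‖lam‖₊ ^ 2))) (𝓝[≠] 0)
      (𝓝 (min 1 (min (κ / 2) (κ / (1 + κ))) / 3)) := by
  have hcont : Continuous fun p : ℝ × ℝ =>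
      min (1 / 3 * min 1 (min (κ / (2 + 2 * κ * p.1 ^ 2)) (κ / (1 + κ))))
        (κ / (6 * (1 + 2 * p.1 ^ 2)) * (1 - √(3 * p.2)) ^ 2) := by
    fun_prop (disch := intro p; positivity)
  have hlim := (hcont.tendsto (0, 0)).comp
    (tendsto_norm_punctured_nhds_zero.prodMk_nhds tendsto_fSup)
  have hmin : min 1 (min (κ / 2) (κ / (1 + κ))) ≤ κ / 2 := by simp
  refine hlim.trans_eq (congrArg 𝓝 ?_)
  norm_num
  rw [min_eq_left (by linarith)]
  ring

/-- The site at the signed displacement `j` from `x`. -/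
def site {L : ℕ} (x : Fin L) (j : ℤ) : Fin L :=
  ⟨((x + j) % L).toNat, by have := x.pos; have := Int.emod_lt_of_pos (x + j : ℤ) (b := L); omega⟩

/-- The site at the displacement `j` from `x` is occupied. -/
def occ {L : ℕ} (X : Config L) (x : Fin L) (j : ℤ) : Prop := X (site x j) = 1

section Ring

variable {L : ℕ}

theorem coe_site (x : Fin L) (j : ℤ) : ((site x j : ℕ) : ℤ) = (x + j) % L :=
  Int.toNat_of_nonneg (Int.emod_nonneg _ (by have := x.pos; omega))

theorem fin_ext_int {x y : Fin L} (h : ((x : ℕ) : ℤ) = (y : ℕ)) : x = y :=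
  Fin.ext (by exact_mod_cast h)

@[simp]
theorem site_zero (x : Fin L) : site x 0 = x :=
  fin_ext_int <| by rw [coe_site, add_zero, Int.emod_eq_of_lt] <;> omega

@[simp]
theorem site_site (x : Fin L) (i j : ℤ) : site (site x i) j = site x (i + j) :=
  fin_ext_int <| by simp only [coe_site, Int.emod_add_emod, add_assoc]

theorem ringShift_eq_site (x : Fin L) (d : ℕ) : ringShift x d = site x d :=
  fin_ext_int <| by simp [ringShift, coe_site]

theorem site_inj (x : Fin L) {i j : ℤ} (hij : |i - j| < L) : site x i = site x j ↔ i = j := by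
  refine ⟨fun h => ?_, fun h => h ▸ rfl⟩
  have hmod : (x + i : ℤ) % L = (x + j) % L := by rw [← coe_site, ← coe_site, h]
  have hdvd : (L : ℤ) ∣ i - j := by
    simpa using (Int.ModEq.symm hmod).dvd
  exact sub_eq_zero.1 (Int.eq_zero_of_abs_lt_dvd hdvd hij)

theorem exists_eq_site (x y : Fin L) (a : ℤ) : ∃ j, a ≤ j ∧ j < a + L ∧ y = site x j := by
  have hL : (0 : ℤ) < L := by exact_mod_cast x.pos
  refine ⟨a + (y - x - a) % L, ?_, ?_, fin_ext_int ?_⟩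
  · linarith [Int.emod_nonneg (y - x - a : ℤ) hL.ne']
  · linarith [Int.emod_lt_of_pos (y - x - a : ℤ) hL]
  · rw [coe_site, ← add_assoc, Int.add_emod_emod, Int.emod_eq_of_lt] <;> [ring; omega; omega]

theorem site_bijective (k : ℤ) : Function.Bijective fun x : Fin L => site x k :=
  Function.bijective_iff_has_inverse.2 ⟨fun x => site x (-k), by intro; simp, by intro; simp⟩

theorem occ_site (X : Config L) (x : Fin L) (i j : ℤ) : occ X (site x i) j ↔ occ X x (i + j) := by
  rw [occ, occ, site_site]

end Ring

section Patterns

/-- The block of a dimer, `0110`, at the position `i` of the occupation pattern `u`. -/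
def DimerAt (u : ℤ → Prop) (i : ℤ) : Prop := ¬u i ∧ u (i + 1) ∧ u (i + 2) ∧ ¬u (i + 3)

/-- The block of a pair of monomers, `1001`, at the position `i` of the occupation pattern `u`. -/
def PairAt (u : ℤ → Prop) (i : ℤ) : Prop := u i ∧ ¬u (i + 1) ∧ ¬u (i + 2) ∧ u (i + 3)

/-- At the position `i` the occupation pattern `u` shows none of `1∗1`, `11∗∗1`, `1∗∗11` and
`11∗∗∗11`. -/
def AvoidsAt (u : ℤ → Prop) (i : ℤ) : Prop :=
  ¬(u i ∧ u (i + 2)) ∧ ¬(u i ∧ u (i + 1) ∧ u (i + 4)) ∧ ¬(u i ∧ u (i + 3) ∧ u (i + 4)) ∧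
    ¬(u i ∧ u (i + 1) ∧ u (i + 5) ∧ u (i + 6))

theorem avoidsAt_of_exchange {u w : ℤ → Prop} (hu : ∀ i, AvoidsAt u i)
    (hmove : DimerAt u 0 ∨ PairAt u 0)
    (hw : ∀ j, -6 ≤ j → j < 10 → (w j ↔ if 0 ≤ j ∧ j < 4 then ¬u j else u j))
    {i : ℤ} (hi : -6 ≤ i) (hi' : i < 4) : AvoidsAt w i := by
  simp only [AvoidsAt, DimerAt, PairAt] at *
  interval_cases i <;> norm_num <;> grind

end Patterns

section Blocks

variable {L : ℕ}

/-- The four consecutive sites starting at `x`, on which the operator `q_x` acts. -/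
noncomputable def block (x : Fin L) : Finset (Fin L) := (Finset.Ico (0 : ℤ) 4).image (site x)

/-- Exchange particles and holes on the block of `x`. This turns a dimer into a pair of monomers
and conversely. -/
noncomputable def toggle (x : Fin L) (X : Config L) : Config L :=
  fun y => if y ∈ block x then 1 - X y else X y

/-- Remove all particles from the block of `x`. -/
noncomputable def clearBlock (x : Fin L) (X : Config L) : Config L :=
  fun y => if y ∈ block x then 0 else X y

/-- The configuration has a dimer `0110` on the block of `x`. -/
def IsDimer (X : Config L) (x : Fin L) : Prop := DimerAt (occ X x) 0

/-- The configuration has a pair of monomers `1001` on the block of `x`. -/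
def IsPair (X : Config L) (x : Fin L) : Prop := PairAt (occ X x) 0

/-- The configurations read off from the tilings of the ring by voids `0`, monomers `100` and dimers
`011000`, encoded by their forbidden patterns. -/
def IsTiling (X : Config L) : Prop := ∀ x, AvoidsAt (occ X x) 0

theorem fin_two_one_sub_eq_one_iff {a : Fin 2} : 1 - a = 1 ↔ ¬a = 1 := by omega

theorem avoidsAt_occ_site (X : Config L) (x : Fin L) (i : ℤ) :
    AvoidsAt (occ X (site x i)) 0 ↔ AvoidsAt (occ X x) i := by
  simp only [AvoidsAt, occ_site, add_zero, zero_add]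

theorem isDimer_site (X : Config L) (x : Fin L) (i : ℤ) :
    IsDimer X (site x i) ↔ DimerAt (occ X x) i := by
  simp only [IsDimer, DimerAt, occ_site, add_zero, zero_add]

theorem isPair_site (X : Config L) (x : Fin L) (i : ℤ) :
    IsPair X (site x i) ↔ PairAt (occ X x) i := by
  simp only [IsPair, PairAt, occ_site, add_zero, zero_add]

theorem IsTiling.avoidsAt {X : Config L} (hX : IsTiling X) (x : Fin L) (i : ℤ) :
    AvoidsAt (occ X x) i :=
  (avoidsAt_occ_site X x i).1 (hX _)

theorem toggle_apply_eq_one (x y : Fin L) (X : Config L) :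
    toggle x X y = 1 ↔ if y ∈ block x then ¬X y = 1 else X y = 1 := by
  unfold toggle
  split_ifs
  · exact fin_two_one_sub_eq_one_iff
  · rfl

theorem toggle_toggle (x : Fin L) (X : Config L) : toggle x (toggle x X) = X := by
  ext y
  simp only [toggle]
  split_ifs <;> omega

theorem toggle_comm (x y : Fin L) (X : Config L) :
    toggle x (toggle y X) = toggle y (toggle x X) := by
  ext z
  simp only [toggle]
  split_ifs <;> rfl

theorem clearBlock_toggle (x : Fin L) (X : Config L) :
    clearBlock x (toggle x X) = clearBlock x X := by
  ext y
  simp only [clearBlock, toggle]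
  split_ifs <;> rfl

theorem mem_block {x y : Fin L} : y ∈ block x ↔ ∃ j, (0 ≤ j ∧ j < 4) ∧ site x j = y := by
  simp only [block, Finset.mem_image, Finset.mem_Ico]

theorem site_mem_block (x : Fin L) {j : ℤ} (hj : 4 - L ≤ j) (hj' : j < L) :
    site x j ∈ block x ↔ 0 ≤ j ∧ j < 4 := by
  rw [mem_block]
  refine ⟨fun ⟨i, hi, hij⟩ => ?_, fun h => ⟨j, h, rfl⟩⟩
  rwa [(site_inj x (by rw [abs_lt]; omega)).1 hij] at hi

theorem occ_toggle (x : Fin L) (X : Config L) {j : ℤ} (hj : 4 - L ≤ j) (hj' : j < L) :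
    occ (toggle x X) x j ↔ if 0 ≤ j ∧ j < 4 then ¬occ X x j else occ X x j := by
  simp only [occ, toggle_apply_eq_one, site_mem_block x hj hj']

theorem occ_clearBlock (x : Fin L) (X : Config L) {j : ℤ} (hj : 4 - L ≤ j) (hj' : j < L) :
    occ (clearBlock x X) x j ↔ ¬(0 ≤ j ∧ j < 4) ∧ occ X x j := by
  simp only [occ, clearBlock, site_mem_block x hj hj']
  split_ifs with h <;> simp [h]

theorem IsTiling.isTiling_toggle (hL : 20 ≤ L) {X : Config L} {x : Fin L} (hX : IsTiling X)
    (hmove : IsDimer X x ∨ IsPair X x) : IsTiling (toggle x X) := by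
  intro y
  obtain ⟨i, hi, hi', rfl⟩ := exists_eq_site x y (-6)
  rw [avoidsAt_occ_site]
  rcases lt_or_ge i 4 with h4 | h4
  · exact avoidsAt_of_exchange (hX.avoidsAt x) hmove
      (fun j hj hj' => occ_toggle x X (by omega) (by omega)) hi h4
  · have hoff : ∀ j, i ≤ j → j ≤ i + 6 → (occ (toggle x X) x j ↔ occ X x j) :=
      fun j hj hj' => by rw [occ_toggle x X (by omega) (by omega), if_neg (by omega)]
    have havoid := hX.avoidsAt x i
    simp only [AvoidsAt] at havoid ⊢
    simpa (disch := omega) only [hoff] using havoid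

theorem isPair_toggle_iff (hL : 4 ≤ L) (X : Config L) (x : Fin L) :
    IsPair (toggle x X) x ↔ IsDimer X x := by
  have hocc : ∀ j, 0 ≤ j → j < 4 → (occ (toggle x X) x j ↔ ¬occ X x j) := fun j hj hj' => by
    rw [occ_toggle x X (by omega) (by omega), if_pos ⟨hj, hj'⟩]
  simp only [IsPair, PairAt, IsDimer, DimerAt]
  simp (disch := omega) only [hocc, not_not]

theorem isDimer_toggle_iff (hL : 4 ≤ L) (X : Config L) (x : Fin L) :
    IsDimer (toggle x X) x ↔ IsPair X x := by
  rw [← isPair_toggle_iff hL, toggle_toggle]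

theorem exists_eq_site_of_not_disjoint_block {x y : Fin L} (h : ¬Disjoint (block x) (block y)) :
    ∃ j, -4 < j ∧ j < 4 ∧ y = site x j := by
  obtain ⟨z, hx, hy⟩ := Finset.not_disjoint_iff.1 h
  obtain ⟨i, hi, rfl⟩ := mem_block.1 hx
  obtain ⟨j, hj, hij⟩ := mem_block.1 hy
  refine ⟨i - j, by omega, by omega, ?_⟩
  rw [sub_eq_add_neg, ← site_site, ← hij, site_site, add_neg_cancel, site_zero]

theorem occ_toggle_of_disjoint {x y : Fin L} (h : Disjoint (block x) (block y)) (X : Config L)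
    {j : ℤ} (hj : 0 ≤ j) (hj' : j < 4) : occ (toggle x X) y j ↔ occ X y j := by
  have : site y j ∉ block x := Finset.disjoint_right.1 h (mem_block.2 ⟨j, ⟨hj, hj'⟩, rfl⟩)
  simp only [occ, toggle_apply_eq_one, if_neg this]

theorem isDimer_toggle_of_disjoint {x y : Fin L} (h : Disjoint (block x) (block y))
    (X : Config L) : IsDimer (toggle x X) y ↔ IsDimer X y := by
  simp (disch := omega) only [IsDimer, DimerAt, occ_toggle_of_disjoint h]

theorem isPair_toggle_of_disjoint {x y : Fin L} (h : Disjoint (block x) (block y))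
    (X : Config L) : IsPair (toggle x X) y ↔ IsPair X y := by
  simp (disch := omega) only [IsPair, PairAt, occ_toggle_of_disjoint h]

end Blocks

section Operators

variable {L : ℕ}

instance (X : Config L) (x : Fin L) : DecidablePred (occ X x) := fun j =>
  inferInstanceAs (Decidable (X (site x j) = 1))

instance (X : Config L) (x : Fin L) : Decidable (IsDimer X x) := by
  unfold IsDimer DimerAt; infer_instance

instance (X : Config L) (x : Fin L) : Decidable (IsPair X x) := by
  unfold IsPair PairAt; infer_instance

/-- No two particles are at distance two: the configuration has no electrostatic energy. -/
def NoDistanceTwo (X : Config L) : Prop := ∀ x, ¬(occ X x 0 ∧ occ X x 2)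

theorem IsTiling.noDistanceTwo {X : Config L} (hX : IsTiling X) : NoDistanceTwo X :=
  fun x => (hX x).1

theorem lower_apply (x : Fin L) (X Z : Config L) :
    lower x X Z = if X x = 0 ∧ Z = Function.update X x 1 then 1 else 0 := by
  have hentry : ∀ a b : Fin 2, !![(0 : ℂ), 1; 0, 0] a b = if a = 0 ∧ b = 1 then 1 else 0 := by
    intro a b; fin_cases a <;> fin_cases b <;> simp
  simp only [lower, siteOp, Matrix.of_apply, hentry, Function.eq_update_iff, ← ite_and,
    eq_comm (a := X _) (b := Z _)]
  congr 1
  grind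

theorem lower_mulVec (x : Fin L) (v : Config L → ℂ) (X : Config L) :
    (lower x).mulVec v X = if X x = 0 then v (Function.update X x 1) else 0 := by
  simp only [Matrix.mulVec, dotProduct, lower_apply, ite_and]
  split_ifs <;> simp

theorem lower_conjTranspose_mulVec (x : Fin L) (v : Config L → ℂ) (X : Config L) :
    (lower x).conjTranspose.mulVec v X = if X x = 1 then v (Function.update X x 0) else 0 := by
  have hentry : ∀ Z, Z x = 0 ∧ X = Function.update Z x 1 ↔
      X x = 1 ∧ Z = Function.update X x 0 := fun Z => by
    simp only [Function.eq_update_iff]; grind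
  simp only [Matrix.mulVec, dotProduct, Matrix.conjTranspose_apply, lower_apply, hentry, ite_and]
  split_ifs <;> simp

theorem number_mulVec (x : Fin L) (v : Config L → ℂ) (X : Config L) :
    (number x).mulVec v X = if X x = 1 then v X else 0 := by
  rw [number, ← Matrix.mulVec_mulVec, lower_conjTranspose_mulVec]
  split_ifs with h
  · simp [lower_mulVec, ← h]
  · rfl

theorem number_mul_number (x y : Fin L) :
    number x * number y = Matrix.diagonal fun X => if X x = 1 ∧ X y = 1 then 1 else 0 := by
  refine Matrix.ext_of_mulVec_single fun X => funext fun Z => ?_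
  rw [← Matrix.mulVec_mulVec, number_mulVec, number_mulVec, Matrix.mulVec_diagonal, ← ite_and,
    ite_mul, one_mul, zero_mul]

theorem lower_mul_lower_mulVec {x y : Fin L} (hxy : x ≠ y) (v : Config L → ℂ) (X : Config L) :
    (lower x * lower y).mulVec v X =
      if X x = 0 ∧ X y = 0 then v (Function.update (Function.update X x 1) y 1) else 0 := by
  rw [← Matrix.mulVec_mulVec, lower_mulVec, lower_mulVec, Function.update_of_ne hxy.symm, ite_and]

theorem lower_mul_lower_conjTranspose_mulVec {x y : Fin L} (hxy : x ≠ y) (v : Config L → ℂ)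
    (X : Config L) :
    (lower x * lower y).conjTranspose.mulVec v X =
      if X x = 1 ∧ X y = 1 then v (Function.update (Function.update X x 0) y 0) else 0 := by
  rw [Matrix.conjTranspose_mul, ← Matrix.mulVec_mulVec, lower_conjTranspose_mulVec,
    lower_conjTranspose_mulVec, Function.update_of_ne hxy, Function.update_comm hxy, ← ite_and]
  simp only [and_comm]

theorem site_ne_site (hL : 4 ≤ L) (x : Fin L) {i j : ℤ} (hi : 0 ≤ i ∧ i < 4) (hj : 0 ≤ j ∧ j < 4)
    (hij : i ≠ j) : site x i ≠ site x j :=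
  (site_inj x (by rw [abs_lt]; omega)).not.2 hij

theorem dipole_eq_site (lam : ℂ) (x : Fin L) :
    dipole lam x = lower (site x 1) * lower (site x 2) -
      lam • (lower (site x 0) * lower (site x 3)) := by
  simp [dipole, ringShift_eq_site]

theorem dipole_mulVec (hL : 4 ≤ L) (lam : ℂ) (x : Fin L) (v : Config L → ℂ) (X : Config L) :
    (dipole lam x).mulVec v X =
      (if X (site x 1) = 0 ∧ X (site x 2) = 0 then
        v (Function.update (Function.update X (site x 1) 1) (site x 2) 1) else 0) -
      lam * (if X (site x 0) = 0 ∧ X (site x 3) = 0 then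
        v (Function.update (Function.update X (site x 0) 1) (site x 3) 1) else 0) := by
  rw [dipole_eq_site, Matrix.sub_mulVec, Matrix.smul_mulVec, Pi.sub_apply, Pi.smul_apply,
    smul_eq_mul, lower_mul_lower_mulVec (site_ne_site hL x _ _ _),
    lower_mul_lower_mulVec (site_ne_site hL x _ _ _)] <;> norm_num

theorem dipole_conjTranspose_mulVec (hL : 4 ≤ L) (lam : ℂ) (x : Fin L) (v : Config L → ℂ)
    (X : Config L) :
    (dipole lam x).conjTranspose.mulVec v X =
      (if X (site x 1) = 1 ∧ X (site x 2) = 1 then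
        v (Function.update (Function.update X (site x 1) 0) (site x 2) 0) else 0) -
      star lam * (if X (site x 0) = 1 ∧ X (site x 3) = 1 then
        v (Function.update (Function.update X (site x 0) 0) (site x 3) 0) else 0) := by
  rw [dipole_eq_site, Matrix.conjTranspose_sub, Matrix.conjTranspose_smul, Matrix.sub_mulVec,
    Matrix.smul_mulVec, Pi.sub_apply, Pi.smul_apply, smul_eq_mul,
    lower_mul_lower_conjTranspose_mulVec (site_ne_site hL x _ _ _),
    lower_mul_lower_conjTranspose_mulVec (site_ne_site hL x _ _ _)] <;> norm_num

theorem config_ext (x : Fin L) {Y Z : Config L}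
    (h : ∀ j : ℤ, 0 ≤ j → j < L → (occ Y x j ↔ occ Z x j)) : Y = Z := by
  funext y
  obtain ⟨j, hj, hj', rfl⟩ := exists_eq_site x y 0
  have := h j hj (by omega)
  simp only [occ] at this
  omega

theorem occ_update (x : Fin L) (X : Config L) (a : Fin 2) {i j : ℤ} (hij : |j - i| < L) :
    occ (Function.update X (site x i) a) x j ↔ if j = i then a = 1 else occ X x j := by
  simp only [occ, Function.update_apply, site_inj x hij]
  split_ifs <;> rfl

theorem IsDimer.update_eq_clearBlock (hL : 4 ≤ L) {X : Config L} {x : Fin L} (h : IsDimer X x) :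
    Function.update (Function.update X (site x 1) 0) (site x 2) 0 = clearBlock x X := by
  refine config_ext x fun j hj hj' => ?_
  simp only [IsDimer, DimerAt] at h
  rw [occ_update _ _ _ (by grind), occ_update _ _ _ (by grind), occ_clearBlock _ _ (by omega) hj']
  grind

theorem IsPair.update_eq_clearBlock (hL : 4 ≤ L) {X : Config L} {x : Fin L} (h : IsPair X x) :
    Function.update (Function.update X (site x 0) 0) (site x 3) 0 = clearBlock x X := by
  refine config_ext x fun j hj hj' => ?_
  simp only [IsPair, PairAt] at h
  rw [occ_update _ _ _ (by grind), occ_update _ _ _ (by grind), occ_clearBlock _ _ (by omega) hj']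
  grind

theorem IsDimer.update_clearBlock (hL : 4 ≤ L) {X : Config L} {x : Fin L} (h : IsDimer X x) :
    Function.update (Function.update (clearBlock x X) (site x 1) 1) (site x 2) 1 = X := by
  refine config_ext x fun j hj hj' => ?_
  simp only [IsDimer, DimerAt] at h
  rw [occ_update _ _ _ (by grind), occ_update _ _ _ (by grind), occ_clearBlock _ _ (by omega) hj']
  grind

theorem IsPair.update_clearBlock (hL : 4 ≤ L) {X : Config L} {x : Fin L} (h : IsPair X x) :
    Function.update (Function.update (clearBlock x X) (site x 0) 1) (site x 3) 1 = X := by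
  refine config_ext x fun j hj hj' => ?_
  simp only [IsPair, PairAt] at h
  rw [occ_update _ _ _ (by grind), occ_update _ _ _ (by grind), occ_clearBlock _ _ (by omega) hj']
  grind

theorem IsDimer.dipole_mulVec_clearBlock (hL : 4 ≤ L) (lam : ℂ) (v : Config L → ℂ) {X : Config L}
    {x : Fin L} (h : IsDimer X x) :
    (dipole lam x).mulVec v (clearBlock x X) = v X - lam * v (toggle x X) := by
  have hpair := ((isPair_toggle_iff hL X x).2 h).update_clearBlock hL
  rw [clearBlock_toggle] at hpair
  have hempty : ∀ j : ℤ, 0 ≤ j → j < 4 → clearBlock x X (site x j) = 0 := fun j hj hj' =>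
    if_pos (mem_block.2 ⟨j, ⟨hj, hj'⟩, rfl⟩)
  rw [dipole_mulVec hL, if_pos ⟨hempty 1 (by simp) (by simp), hempty 2 (by simp) (by simp)⟩,
    if_pos ⟨hempty 0 (by simp) (by simp), hempty 3 (by simp) (by simp)⟩,
    h.update_clearBlock hL, hpair]

theorem NoDistanceTwo.isDimer_iff {X : Config L} (hX : NoDistanceTwo X) (x : Fin L) :
    IsDimer X x ↔ X (site x 1) = 1 ∧ X (site x 2) = 1 := by
  have h₀ := hX x
  have h₁ := hX (site x 1)
  simp only [occ_site] at h₁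
  simp only [IsDimer, DimerAt, occ] at *
  grind

theorem NoDistanceTwo.isPair_iff {X : Config L} (hX : NoDistanceTwo X) (x : Fin L) :
    IsPair X x ↔ X (site x 0) = 1 ∧ X (site x 3) = 1 := by
  have h₀ := hX x
  have h₁ := hX (site x 1)
  simp only [occ_site] at h₁
  simp only [IsPair, PairAt, occ] at *
  grind

theorem NoDistanceTwo.dipole_conjTranspose_mulVec (hL : 4 ≤ L) (lam : ℂ) (w : Config L → ℂ)
    {X : Config L} (hX : NoDistanceTwo X) (x : Fin L) :
    (dipole lam x).conjTranspose.mulVec w X =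
      (if IsDimer X x then w (clearBlock x X) else 0) -
        star lam * (if IsPair X x then w (clearBlock x X) else 0) := by
  rw [Haldane.dipole_conjTranspose_mulVec hL]
  simp only [← hX.isDimer_iff, ← hX.isPair_iff]
  congr 1
  · split_ifs with h
    · rw [h.update_eq_clearBlock hL]
    · rfl
  · split_ifs with h
    · rw [h.update_eq_clearBlock hL]
    · rfl

theorem NoDistanceTwo.dipole_sq_mulVec (hL : 4 ≤ L) (lam : ℂ) (v : Config L → ℂ) {X : Config L}
    (hX : NoDistanceTwo X) (x : Fin L) :
    ((dipole lam x).conjTranspose * dipole lam x).mulVec v X =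
      (if IsDimer X x then v X - lam * v (toggle x X) else 0) +
      (if IsPair X x then star lam * (lam * v X - v (toggle x X)) else 0) := by
  rw [← Matrix.mulVec_mulVec, hX.dipole_conjTranspose_mulVec hL, sub_eq_add_neg]
  congr 1
  · split_ifs with h
    · rw [h.dipole_mulVec_clearBlock hL]
    · rfl
  · split_ifs with h
    · rw [← clearBlock_toggle,
        ((isDimer_toggle_iff hL X x).2 h).dipole_mulVec_clearBlock hL, toggle_toggle]
      ring
    · simp

theorem periodicHamiltonian_mulVec (κ : ℝ) (lam : ℂ) (v : Config L → ℂ) (X : Config L) :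
    (periodicHamiltonian L κ lam).mulVec v X =
      ∑ x, ((if occ X x 0 ∧ occ X x 2 then v X else 0) +
        κ * ((dipole lam x).conjTranspose * dipole lam x).mulVec v X) := by
  simp [periodicHamiltonian, Matrix.sum_mulVec, Matrix.add_mulVec, Matrix.smul_mulVec,
    number_mul_number, Matrix.mulVec_diagonal, ringShift_eq_site, occ]

theorem IsTiling.periodicHamiltonian_mulVec (hL : 4 ≤ L) (κ : ℝ) (lam : ℂ) (v : Config L → ℂ)
    {X : Config L} (hX : IsTiling X) :
    (periodicHamiltonian L κ lam).mulVec v X =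
      κ * ∑ x, ((if IsDimer X x then v X - lam * v (toggle x X) else 0) +
        (if IsPair X x then star lam * (lam * v X - v (toggle x X)) else 0)) := by
  rw [Haldane.periodicHamiltonian_mulVec, Finset.mul_sum]
  refine Finset.sum_congr rfl fun x _ => ?_
  rw [if_neg (hX.noDistanceTwo x), zero_add, hX.noDistanceTwo.dipole_sq_mulVec hL]

theorem isHermitian_periodicHamiltonian (κ : ℝ) (lam : ℂ) :
    (periodicHamiltonian L κ lam).IsHermitian := by
  refine isSelfAdjoint_sum _ fun x _ => IsSelfAdjoint.add ?_ (IsSelfAdjoint.smul ?_ ?_)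
  · rw [number_mul_number]
    exact Matrix.isHermitian_diagonal_of_self_adjoint _ (by ext X; dsimp; split_ifs <;> simp)
  · simp [IsSelfAdjoint]
  · exact Matrix.isHermitian_conjTranspose_mul_self _

/-- The expectation of `∑ n_x n_{x+2}` in the vector `v`. -/
noncomputable def electrostaticEnergy (v : Config L → ℂ) : ℝ :=
  ∑ p : Fin L × Config L with occ p.2 p.1 0 ∧ occ p.2 p.1 2, ‖v p.2‖ ^ 2

/-- The part of the expectation of `∑ q_x^* q_x` in the vector `v` that comes from the
configurations with a dimer on the block of `x`. -/
noncomputable def dimerEnergy (lam : ℂ) (v : Config L → ℂ) : ℝ :=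
  ∑ p : Fin L × Config L with IsDimer p.2 p.1, ‖v p.2 - lam * v (toggle p.1 p.2)‖ ^ 2

theorem star_dotProduct_self {ι : Type*} [Fintype ι] (v : ι → ℂ) :
    star v ⬝ᵥ v = ((∑ i, ‖v i‖ ^ 2 : ℝ) : ℂ) := by
  simp [dotProduct, Complex.conj_mul']

theorem star_dotProduct_periodicHamiltonian (κ : ℝ) (lam : ℂ) (v : Config L → ℂ) :
    star v ⬝ᵥ (periodicHamiltonian L κ lam).mulVec v =
      ((electrostaticEnergy v + κ * ∑ x, ∑ Z, ‖(dipole lam x).mulVec v Z‖ ^ 2 : ℝ) : ℂ) := by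
  have hdipole : ∀ x : Fin L, star v ⬝ᵥ ((dipole lam x).conjTranspose * dipole lam x).mulVec v =
      ((∑ Z, ‖(dipole lam x).mulVec v Z‖ ^ 2 : ℝ) : ℂ) := fun x => by
    rw [← star_dotProduct_self, ← Matrix.mulVec_mulVec, Matrix.dotProduct_mulVec,
      ← Matrix.star_mulVec]
  have hnumber : ∀ x : Fin L, star v ⬝ᵥ (number x * number (ringShift x 2)).mulVec v =
      ((∑ X : Config L, if occ X x 0 ∧ occ X x 2 then ‖v X‖ ^ 2 else 0 : ℝ) : ℂ) := fun x => by
    simp [dotProduct, number_mul_number, Matrix.mulVec_diagonal, ringShift_eq_site, occ,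
      Complex.conj_mul', apply_ite Complex.ofReal]
  simp only [periodicHamiltonian, Matrix.sum_mulVec, Matrix.add_mulVec, Matrix.smul_mulVec,
    dotProduct_sum, dotProduct_add, dotProduct_smul, hdipole, hnumber, electrostaticEnergy,
    smul_eq_mul, Finset.sum_add_distrib, ← Finset.mul_sum, Finset.sum_filter,
    Fintype.sum_prod_type]
  push_cast
  rfl

theorem dimerEnergy_le (hL : 4 ≤ L) (lam : ℂ) (v : Config L → ℂ) :
    dimerEnergy lam v ≤ ∑ x, ∑ Z, ‖(dipole lam x).mulVec v Z‖ ^ 2 := by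
  rw [dimerEnergy, Finset.sum_filter, Fintype.sum_prod_type]
  refine Finset.sum_le_sum fun x _ => ?_
  rw [← Finset.sum_filter]
  have hinj : Set.InjOn (clearBlock x) ({X | IsDimer X x} : Finset (Config L)) := by
    intro X hX Y hY hXY
    simp only [Finset.coe_filter, Finset.mem_univ, true_and, Set.mem_ofPred_eq] at hX hY
    rw [← hX.update_clearBlock hL, hXY, hY.update_clearBlock hL]
  calc ∑ X with IsDimer X x, ‖v X - lam * v (toggle x X)‖ ^ 2
      = ∑ X with IsDimer X x, ‖(dipole lam x).mulVec v (clearBlock x X)‖ ^ 2 :=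
        Finset.sum_congr rfl fun X hX => by
          rw [IsDimer.dipole_mulVec_clearBlock hL lam v (Finset.mem_filter.1 hX).2]
    _ = ∑ Z ∈ ({X | IsDimer X x} : Finset (Config L)).image (clearBlock x),
        ‖(dipole lam x).mulVec v Z‖ ^ 2 :=
        (Finset.sum_image (f := fun Z => ‖(dipole lam x).mulVec v Z‖ ^ 2) hinj).symm
    _ ≤ ∑ Z, ‖(dipole lam x).mulVec v Z‖ ^ 2 :=
        Finset.sum_le_sum_of_subset_of_nonneg (Finset.subset_univ _) fun _ _ _ => by positivity

end Operators

section NonTilings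

variable {L : ℕ}

instance (X : Config L) : Decidable (NoDistanceTwo X) := by
  unfold NoDistanceTwo; infer_instance

theorem toggle_injective (x : Fin L) : Function.Injective (toggle x) :=
  (show Function.Involutive (toggle x) from toggle_toggle x).injective

theorem site_prodMk_injective (k : ℤ) {e : Fin L → Config L → Config L}
    (he : ∀ x, Function.Injective (e x)) :
    Function.Injective fun p : Fin L × Config L => (site p.1 k, e p.1 p.2) := by
  rintro ⟨x, X⟩ ⟨y, Y⟩ h
  obtain ⟨hxy, hXY⟩ := Prod.mk.inj h
  obtain rfl : x = y := (site_bijective k).injective hxy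
  exact Prod.ext rfl (he x hXY)

theorem sum_filter_comp_le {α : Type*} [Fintype α] {F : α → ℝ} (hF : ∀ a, 0 ≤ F a)
    {P Q : α → Prop} [DecidablePred P] [DecidablePred Q] {e : α → α} (he : Function.Injective e)
    (hPQ : ∀ a, P a → Q (e a)) : ∑ a with P a, F (e a) ≤ ∑ a with Q a, F a := by
  classical
  rw [← Finset.sum_image (f := F) he.injOn]
  refine Finset.sum_le_sum_of_subset_of_nonneg (fun b hb => ?_) fun a _ _ => hF a
  obtain ⟨a, ha, rfl⟩ := Finset.mem_image.1 hb
  exact Finset.mem_filter.2 ⟨Finset.mem_univ _, hPQ a (Finset.mem_filter.1 ha).2⟩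

theorem sum_filter_or_le {α : Type*} [Fintype α] {F : α → ℝ} (hF : ∀ a, 0 ≤ F a)
    (P Q : α → Prop) [DecidablePred P] [DecidablePred Q] :
    ∑ a with P a ∨ Q a, F a ≤ ∑ a with P a, F a + ∑ a with Q a, F a := by
  classical
  rw [Finset.filter_or, ← Finset.sum_union_inter]
  exact le_add_of_nonneg_right (Finset.sum_nonneg fun a _ => hF a)

theorem sum_le_sum_filter_prod {α β : Type*} [Fintype α] [Fintype β] {F : β → ℝ}
    (hF : ∀ b, 0 ≤ F b) {P : α × β → Prop} [DecidablePred P] (hP : ∀ b, F b ≠ 0 → ∃ a, P (a, b)) :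
    ∑ b, F b ≤ ∑ p with P p, F p.2 := by
  rw [Finset.sum_filter, Fintype.sum_prod_type_right]
  refine Finset.sum_le_sum fun b _ => ?_
  have hterm : ∀ a, 0 ≤ if P (a, b) then F b else 0 := fun a => ite_nonneg (hF b) le_rfl
  rcases eq_or_ne (F b) 0 with hb | hb
  · exact hb.trans_le (Finset.sum_nonneg fun a _ => hterm a)
  · obtain ⟨a, ha⟩ := hP b hb
    calc F b = if P (a, b) then F b else 0 := (if_pos ha).symm
      _ ≤ _ := Finset.single_le_sum (fun a _ => hterm a) (Finset.mem_univ a)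

theorem norm_sq_le_two_terms {κ : ℝ} (hκ : 0 < κ) (lam a b : ℂ) :
    ‖a‖ ^ 2 ≤ (1 / κ + ‖lam‖ ^ 2) * (‖b‖ ^ 2 + κ * ‖a - lam * b‖ ^ 2) := by
  have htri : ‖a‖ ≤ ‖a - lam * b‖ + ‖lam‖ * ‖b‖ := by
    simpa using norm_add_le (a - lam * b) (lam * b)
  have hcs : (1 / κ + ‖lam‖ ^ 2) * (‖b‖ ^ 2 + κ * ‖a - lam * b‖ ^ 2) -
      (‖a - lam * b‖ + ‖lam‖ * ‖b‖) ^ 2 = (‖b‖ - κ * ‖lam‖ * ‖a - lam * b‖) ^ 2 / κ := by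
    field_simp
    ring
  have : 0 ≤ (‖b‖ - κ * ‖lam‖ * ‖a - lam * b‖) ^ 2 / κ := by positivity
  have : ‖a‖ ^ 2 ≤ (‖a - lam * b‖ + ‖lam‖ * ‖b‖) ^ 2 := by gcongr
  linarith

theorem norm_sq_le_three_terms {κ : ℝ} (hκ : 0 < κ) (a b c : ℂ) :
    ‖a‖ ^ 2 ≤ (2 / κ + 1) * (‖c‖ ^ 2 + κ * (‖a - b‖ ^ 2 + ‖c - b‖ ^ 2)) := by
  have htri : ‖a‖ ≤ ‖a - b‖ + ‖c - b‖ + ‖c‖ := by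
    have := norm_add_le (a - b - (c - b)) c
    have := norm_sub_le (a - b) (c - b)
    rw [sub_sub_sub_cancel_right, sub_add_cancel] at *
    linarith
  have hcs : (2 / κ + 1) * (‖c‖ ^ 2 + κ * (‖a - b‖ ^ 2 + ‖c - b‖ ^ 2)) -
      (‖a - b‖ + ‖c - b‖ + ‖c‖) ^ 2 = (‖a - b‖ - ‖c - b‖) ^ 2 +
        ((‖c‖ - κ * ‖a - b‖) ^ 2 + (‖c‖ - κ * ‖c - b‖) ^ 2) / κ := by
    field_simp
    ring
  have : 0 ≤ (‖a - b‖ - ‖c - b‖) ^ 2 +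
      ((‖c‖ - κ * ‖a - b‖) ^ 2 + (‖c‖ - κ * ‖c - b‖) ^ 2) / κ := by positivity
  have : ‖a‖ ^ 2 ≤ (‖a - b‖ + ‖c - b‖ + ‖c‖) ^ 2 := by gcongr
  linarith

theorem isTiling_or_exists_pattern (X : Config L) : IsTiling X ∨ ∃ x,
    (occ X x 0 ∧ occ X x 2) ∨ (IsDimer X x ∧ occ X x 5) ∨ (IsDimer X x ∧ occ X x (-2)) ∨
      (NoDistanceTwo X ∧ IsDimer X x ∧ occ X x 6 ∧ occ X x 7) := by
  by_cases hX : NoDistanceTwo X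
  swap
  · simp only [NoDistanceTwo, not_forall, not_not] at hX
    exact .inr (hX.imp fun x hx => .inl hx)
  rw [or_iff_not_imp_right]
  intro hnone x
  simp only [not_exists, not_or] at hnone
  have hdimer : ∀ j, occ X x (j + 1) ∧ occ X x (j + 2) → DimerAt (occ X x) j := fun j hj =>
    (isDimer_site X x j).1 ((hX.isDimer_iff _).2 (by simpa only [site_site, occ] using hj))
  have hleft := hnone (site x (-1))
  have hright := hnone (site x 2)
  have := hX x
  have hdl := hdimer (-1)
  have hdr := hdimer 2
  simp only [isDimer_site, occ_site, hX, true_and] at hleft hright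
  norm_num at hleft hright hdl hdr
  simp only [AvoidsAt]
  norm_num
  grind

theorem sum_norm_sq_le_of_occ_toggle {κ : ℝ} (hκ : 0 < κ) (lam : ℂ) (v : Config L → ℂ) (k : ℤ)
    (P : Fin L × Config L → Prop) [DecidablePred P] (hdimer : ∀ p, P p → IsDimer p.2 p.1)
    (hocc : ∀ p, P p → occ (toggle p.1 p.2) p.1 k ∧ occ (toggle p.1 p.2) p.1 (k + 2)) :
    ∑ p with P p, ‖v p.2‖ ^ 2 ≤
      (1 / κ + ‖lam‖ ^ 2) * (electrostaticEnergy v + κ * dimerEnergy lam v) := by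
  have hmoved : ∑ p with P p, ‖v (toggle p.1 p.2)‖ ^ 2 ≤ electrostaticEnergy v := by
    refine sum_filter_comp_le (F := fun p : Fin L × Config L => ‖v p.2‖ ^ 2)
      (e := fun p => (site p.1 k, toggle p.1 p.2)) (fun _ => by positivity)
      (site_prodMk_injective k toggle_injective) fun p hp => ?_
    simpa only [occ_site, add_zero] using hocc p hp
  have hchange : ∑ p with P p, ‖v p.2 - lam * v (toggle p.1 p.2)‖ ^ 2 ≤ dimerEnergy lam v :=
    sum_filter_comp_le (F := fun p : Fin L × Config L => ‖v p.2 - lam * v (toggle p.1 p.2)‖ ^ 2)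
      (fun _ => by positivity) Function.injective_id hdimer
  calc ∑ p with P p, ‖v p.2‖ ^ 2
      ≤ ∑ p with P p, (1 / κ + ‖lam‖ ^ 2) *
          (‖v (toggle p.1 p.2)‖ ^ 2 + κ * ‖v p.2 - lam * v (toggle p.1 p.2)‖ ^ 2) :=
        Finset.sum_le_sum fun p _ => norm_sq_le_two_terms hκ lam _ _
    _ = (1 / κ + ‖lam‖ ^ 2) * (∑ p with P p, ‖v (toggle p.1 p.2)‖ ^ 2 +
          κ * ∑ p with P p, ‖v p.2 - lam * v (toggle p.1 p.2)‖ ^ 2) := by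
        simp only [Finset.mul_sum, Finset.sum_add_distrib, mul_add]
    _ ≤ _ := by gcongr

theorem isDimer_toggle_toggle_of_double_dimer (hL : 20 ≤ L) {X : Config L} {x : Fin L}
    (hX : NoDistanceTwo X) (hdimer : IsDimer X x) (h₆ : occ X x 6) (h₇ : occ X x 7) :
    IsDimer (toggle (site x 3) (toggle x X)) (site x 3) ∧
      occ (toggle (site x 3) (toggle x X)) x 5 ∧ occ (toggle (site x 3) (toggle x X)) x 7 := by
  have hfirst : ∀ j : ℤ, 0 ≤ j → j < 8 →
      (occ (toggle x X) x j ↔ if 0 ≤ j ∧ j < 4 then ¬occ X x j else occ X x j) :=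
    fun j hj hj' => occ_toggle x X (by omega) (by omega)
  have h₄ : ¬occ X x 4 := fun h => hX (site x 4) (by simp only [occ_site]; exact ⟨h, h₆⟩)
  have h₅ : ¬occ X x 5 := fun h => hX (site x 5) (by simp only [occ_site]; exact ⟨h, h₇⟩)
  have hpair : IsPair (toggle x X) (site x 3) := by
    simp only [IsDimer, DimerAt] at hdimer
    simp only [isPair_site, PairAt]
    norm_num
    simp (disch := norm_num) only [hfirst]
    norm_num at hdimer ⊢
    exact ⟨hdimer.2.2.2, h₄, h₅, h₆⟩
  have hmoved := (isDimer_toggle_iff (by omega) _ _).2 hpair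
  refine ⟨hmoved, ?_, ?_⟩
  · simpa only [IsDimer, DimerAt, occ_site, zero_add, Int.reduceAdd] using hmoved.2.2.1
  · have hsecond := occ_toggle (site x 3) (toggle x X) (j := 4) (by omega) (by omega)
    rw [if_neg (by norm_num), occ_site, occ_site] at hsecond
    exact hsecond.2 ((hfirst 7 (by norm_num) (by norm_num)).2 (by simpa using h₇))

theorem sum_norm_sq_double_dimer_le (hL : 20 ≤ L) {κ : ℝ} (hκ : 0 < κ) (lam : ℂ)
    (v : Config L → ℂ) :
    ∑ p : Fin L × Config L with
        NoDistanceTwo p.2 ∧ IsDimer p.2 p.1 ∧ occ p.2 p.1 6 ∧ occ p.2 p.1 7, ‖v p.2‖ ^ 2 ≤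
      (2 / κ + 1) * (electrostaticEnergy v + κ * dimerEnergy lam v) := by
  let P : Fin L × Config L → Prop := fun p =>
    NoDistanceTwo p.2 ∧ IsDimer p.2 p.1 ∧ occ p.2 p.1 6 ∧ occ p.2 p.1 7
  let moved : Fin L → Config L → Config L := fun x X => toggle (site x 3) (toggle x X)
  let D : Fin L × Config L → ℝ := fun p => ‖v p.2 - lam * v (toggle p.1 p.2)‖ ^ 2
  have hinj : ∀ x, Function.Injective (moved x) := fun x =>
    (toggle_injective _).comp (toggle_injective x)
  have hP : ∀ p, P p → IsDimer (moved p.1 p.2) (site p.1 3) ∧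
      occ (moved p.1 p.2) p.1 5 ∧ occ (moved p.1 p.2) p.1 7 := fun p hp =>
    isDimer_toggle_toggle_of_double_dimer hL hp.1 hp.2.1 hp.2.2.1 hp.2.2.2
  have hmoved : ∑ p with P p, ‖v (moved p.1 p.2)‖ ^ 2 ≤ electrostaticEnergy v := by
    refine sum_filter_comp_le (F := fun p : Fin L × Config L => ‖v p.2‖ ^ 2)
      (e := fun p => (site p.1 5, moved p.1 p.2)) (fun _ => by positivity)
      (site_prodMk_injective 5 hinj) fun p hp => ?_
    simpa only [occ_site, Int.reduceAdd] using (hP p hp).2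
  have hchange₁ : ∑ p with P p, D p ≤ ∑ p with IsDimer p.2 p.1 ∧ NoDistanceTwo p.2, D p :=
    sum_filter_comp_le (F := D) (fun _ => by positivity) Function.injective_id
      fun p hp => ⟨hp.2.1, hp.1⟩
  have hchange₂ : ∑ p with P p, D (site p.1 3, moved p.1 p.2) ≤
      ∑ p with IsDimer p.2 p.1 ∧ ¬NoDistanceTwo p.2, D p :=
    sum_filter_comp_le (F := D) (fun _ => by positivity) (site_prodMk_injective 3 hinj)
      fun p hp => ⟨(hP p hp).1, fun h =>
        h (site p.1 5) (by simpa only [occ_site, Int.reduceAdd] using (hP p hp).2)⟩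
  have hchange : ∑ p with P p, D p + ∑ p with P p, D (site p.1 3, moved p.1 p.2) ≤
      dimerEnergy lam v := by
    refine (add_le_add hchange₁ hchange₂).trans_eq ?_
    rw [dimerEnergy, ← Finset.filter_filter, ← Finset.filter_filter]
    exact Finset.sum_filter_add_sum_filter_not _ _ _
  calc ∑ p with P p, ‖v p.2‖ ^ 2
      ≤ ∑ p with P p, (2 / κ + 1) *
          (‖v (moved p.1 p.2)‖ ^ 2 + κ * (D p + D (site p.1 3, moved p.1 p.2))) :=
        Finset.sum_le_sum fun p _ => by
          simpa only [D, moved, toggle_toggle] using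
            norm_sq_le_three_terms hκ (v p.2) (lam * v (toggle p.1 p.2)) (v (moved p.1 p.2))
    _ = (2 / κ + 1) * (∑ p with P p, ‖v (moved p.1 p.2)‖ ^ 2 +
          κ * (∑ p with P p, D p + ∑ p with P p, D (site p.1 3, moved p.1 p.2))) := by
        simp only [Finset.mul_sum, Finset.sum_add_distrib, mul_add]
    _ ≤ _ := by gcongr

theorem sum_norm_sq_le_of_eq_zero_of_isTiling (hL : 20 ≤ L) {κ : ℝ} (hκ : 0 < κ) (lam : ℂ)
    {v : Config L → ℂ} (hv : ∀ X, IsTiling X → v X = 0) :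
    ∑ X, ‖v X‖ ^ 2 ≤ (2 + 4 / κ + 2 * ‖lam‖ ^ 2) *
      (electrostaticEnergy v + κ * dimerEnergy lam v) := by
  let F : Fin L × Config L → ℝ := fun p => ‖v p.2‖ ^ 2
  have hF : ∀ p, 0 ≤ F p := fun _ => by positivity
  have hright : ∑ p : Fin L × Config L with IsDimer p.2 p.1 ∧ occ p.2 p.1 5, F p ≤
      (1 / κ + ‖lam‖ ^ 2) * (electrostaticEnergy v + κ * dimerEnergy lam v) := by
    refine sum_norm_sq_le_of_occ_toggle hκ lam v 3 _ (fun p hp => hp.1) fun p hp => ?_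
    rw [occ_toggle _ _ (by omega) (by omega), occ_toggle _ _ (by omega) (by omega)]
    exact ⟨by simpa using hp.1.2.2.2, by simpa using hp.2⟩
  have hleft : ∑ p : Fin L × Config L with IsDimer p.2 p.1 ∧ occ p.2 p.1 (-2), F p ≤
      (1 / κ + ‖lam‖ ^ 2) * (electrostaticEnergy v + κ * dimerEnergy lam v) := by
    refine sum_norm_sq_le_of_occ_toggle hκ lam v (-2) _ (fun p hp => hp.1) fun p hp => ?_
    rw [occ_toggle _ _ (by omega) (by omega), occ_toggle _ _ (by omega) (by omega)]
    exact ⟨by simpa using hp.2, by simpa using hp.1.1⟩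
  have hdouble := sum_norm_sq_double_dimer_le hL hκ lam v
  calc ∑ X, ‖v X‖ ^ 2
      ≤ ∑ p : Fin L × Config L with (occ p.2 p.1 0 ∧ occ p.2 p.1 2) ∨
          (IsDimer p.2 p.1 ∧ occ p.2 p.1 5) ∨ (IsDimer p.2 p.1 ∧ occ p.2 p.1 (-2)) ∨
          (NoDistanceTwo p.2 ∧ IsDimer p.2 p.1 ∧ occ p.2 p.1 6 ∧ occ p.2 p.1 7), F p :=
        sum_le_sum_filter_prod (fun _ => by positivity) fun X hX =>
          (isTiling_or_exists_pattern X).resolve_left fun h => hX (by simp [hv X h])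
    _ ≤ electrostaticEnergy v +
          ((1 / κ + ‖lam‖ ^ 2) * (electrostaticEnergy v + κ * dimerEnergy lam v) +
          ((1 / κ + ‖lam‖ ^ 2) * (electrostaticEnergy v + κ * dimerEnergy lam v) +
          (2 / κ + 1) * (electrostaticEnergy v + κ * dimerEnergy lam v))) := by
        refine (sum_filter_or_le hF _ _).trans (add_le_add_right ?_ _)
        refine (sum_filter_or_le hF _ _).trans (add_le_add hright ?_)
        exact (sum_filter_or_le hF _ _).trans (add_le_add hleft hdouble)
    _ = (2 + 4 / κ + 2 * ‖lam‖ ^ 2) * (electrostaticEnergy v + κ * dimerEnergy lam v) -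
          κ * dimerEnergy lam v := by ring
    _ ≤ _ := sub_le_self _ (mul_nonneg hκ.le (Finset.sum_nonneg fun _ _ => by positivity))

end NonTilings

section BlockDiagonal

variable {L : ℕ}

theorem mulVec_indicator_compl {ι : Type*} [Fintype ι] {H : Matrix ι ι ℂ} (hH : H.IsHermitian)
    {S : Set ι} (hS : ∀ i ∈ S, ∀ j ∉ S, H i j = 0) {v : ι → ℂ} {μ : ℂ}
    (hv : H.mulVec v = μ • v) : H.mulVec (Sᶜ.indicator v) = μ • Sᶜ.indicator v := by
  classical
  funext i
  simp only [Matrix.mulVec, dotProduct, Pi.smul_apply, Set.indicator_apply, Set.mem_compl_iff,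
    smul_eq_mul]
  by_cases hi : i ∈ S
  · rw [if_neg (not_not.2 hi), mul_zero]
    refine Finset.sum_eq_zero fun j _ => ?_
    split_ifs with hj
    · exact mul_zero _
    · rw [hS i hi j hj, zero_mul]
  · rw [if_pos hi, ← smul_eq_mul, ← Pi.smul_apply, ← hv]
    refine Finset.sum_congr rfl fun j _ => ?_
    split_ifs with hj
    · have hij : H i j = 0 := by rw [← hH.apply i j, hS j hj i hi, star_zero]
      simp only [hij, mul_zero, zero_mul]
    · rfl

theorem periodicHamiltonian_apply_eq_zero (hL : 20 ≤ L) (κ : ℝ) (lam : ℂ) {X Z : Config L}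
    (hX : IsTiling X) (hZ : ¬IsTiling Z) : periodicHamiltonian L κ lam X Z = 0 := by
  have hne : ∀ {Y : Config L}, IsTiling Y → (Pi.single Z 1 : Config L → ℂ) Y = 0 := fun hY =>
    Pi.single_eq_of_ne (by rintro rfl; exact hZ hY) _
  have happly := hX.periodicHamiltonian_mulVec (by omega) κ lam (Pi.single Z 1)
  rw [Matrix.mulVec_single_one] at happly
  refine happly.trans (mul_eq_zero_of_right _ (Finset.sum_eq_zero fun x _ => ?_))
  rw [hne hX]
  split_ifs with hdimer hpair hpair
  · simp [hne (hX.isTiling_toggle hL (.inl hdimer))]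
  · simp [hne (hX.isTiling_toggle hL (.inl hdimer))]
  · simp [hne (hX.isTiling_toggle hL (.inr hpair))]
  · simp

theorem inv_le_eigenvalue_of_eq_zero_of_isTiling (hL : 20 ≤ L) {κ : ℝ} (hκ : 0 < κ) (lam : ℂ)
    {v : Config L → ℂ} {μ : ℝ} (hv : (periodicHamiltonian L κ lam).mulVec v = (μ : ℂ) • v)
    (hv₀ : v ≠ 0) (htiling : ∀ X, IsTiling X → v X = 0) :
    1 / (2 + 4 / κ + 2 * ‖lam‖ ^ 2) ≤ μ := by
  have henergy : electrostaticEnergy v + κ * ∑ x, ∑ Z, ‖(dipole lam x).mulVec v Z‖ ^ 2 =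
      μ * ∑ X, ‖v X‖ ^ 2 := by
    have h := star_dotProduct_periodicHamiltonian κ lam v
    rw [hv, dotProduct_smul, star_dotProduct_self, smul_eq_mul] at h
    exact_mod_cast h.symm
  have hpos : 0 < ∑ X, ‖v X‖ ^ 2 := by
    obtain ⟨X, hX⟩ := Function.ne_iff.1 hv₀
    exact Finset.sum_pos' (fun _ _ => by positivity)
      ⟨X, Finset.mem_univ _, pow_pos (norm_pos_iff.2 hX) 2⟩
  rw [div_le_iff₀' (by positivity)]
  refine le_of_mul_le_mul_right ?_ hpos
  calc 1 * ∑ X, ‖v X‖ ^ 2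
      ≤ (2 + 4 / κ + 2 * ‖lam‖ ^ 2) * (electrostaticEnergy v + κ * dimerEnergy lam v) := by
        simpa only [one_mul] using sum_norm_sq_le_of_eq_zero_of_isTiling hL hκ lam htiling
    _ ≤ (2 + 4 / κ + 2 * ‖lam‖ ^ 2) *
          (electrostaticEnergy v + κ * ∑ x, ∑ Z, ‖(dipole lam x).mulVec v Z‖ ^ 2) := by
        gcongr
        exact dimerEnergy_le (by omega) lam v
    _ = (2 + 4 / κ + 2 * ‖lam‖ ^ 2) * μ * ∑ X, ‖v X‖ ^ 2 := by rw [henergy, mul_assoc]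

end BlockDiagonal

section LocalPatterns

theorem DimerAt.not_dimerAt_or_pairAt {u : ℤ → Prop} (h : DimerAt u 0) (hu : ∀ i, AvoidsAt u i)
    {j : ℤ} (hj : -6 < j) (hj' : j < 6) (hj₀ : j ≠ 0) : ¬(DimerAt u j ∨ PairAt u j) := by
  simp only [AvoidsAt, DimerAt, PairAt] at *
  interval_cases j <;> norm_num <;> grind

theorem DimerAt.exchange_not_dimerAt {u w : ℤ → Prop} (h : DimerAt u 0) (hu : ∀ i, AvoidsAt u i)
    (hw : ∀ j, -6 ≤ j → j < 10 → (w j ↔ if 0 ≤ j ∧ j < 4 then ¬u j else u j))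
    {j : ℤ} (hj : -4 < j) (hj' : j < 4) (hj₀ : j ≠ 0) : ¬DimerAt w j := by
  simp only [AvoidsAt, DimerAt] at *
  interval_cases j <;> norm_num <;> grind

theorem DimerAt.exchange_pairAt_iff {u w : ℤ → Prop} (h : DimerAt u 0) (hu : ∀ i, AvoidsAt u i)
    (hw : ∀ j, -6 ≤ j → j < 10 → (w j ↔ if 0 ≤ j ∧ j < 4 then ¬u j else u j))
    {j : ℤ} (hj : -4 < j) (hj' : j < 4) (hj₀ : j ≠ 0) :
    PairAt w j ↔ (j = 3 ∧ u 6) ∨ (j = -3 ∧ u (-3)) := by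
  simp only [AvoidsAt, DimerAt, PairAt] at *
  interval_cases j <;> norm_num <;> grind

theorem DimerAt.pairAt_six_iff {u : ℤ → Prop} (h : DimerAt u 0) (hu : ∀ i, AvoidsAt u i)
    (h₆ : u 6) : PairAt u 6 ↔ u 9 := by
  simp only [AvoidsAt, DimerAt, PairAt] at *
  norm_num at *
  grind

theorem DimerAt.pairAt_neg_six_iff {u : ℤ → Prop} (h : DimerAt u 0) (hu : ∀ i, AvoidsAt u i)
    (h₃ : u (-3)) : PairAt u (-6) ↔ u (-6) := by
  simp only [AvoidsAt, DimerAt, PairAt] at *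
  norm_num at *
  grind

end LocalPatterns

section Generator

variable {L : ℕ}

/-- The transition rates of the jump process on tilings in which a dimer decays into a pair of
monomers at rate `1`, and the pair recombines at rate `r`. -/
noncomputable def rate (r : ℝ) (X : Config L) (x : Fin L) : ℝ :=
  if IsDimer X x then 1 else if IsPair X x then r else 0

/-- The negative of the generator of the jump process with the transition rates `rate r`. -/
noncomputable def generator (r : ℝ) (f : Config L → ℂ) (X : Config L) : ℂ :=
  ∑ y, rate r X y * (f X - f (toggle y X))

/-- The change of `f` when the particles on the block of `x` are exchanged. -/
noncomputable def increment (f : Config L → ℂ) (X : Config L) (x : Fin L) : ℂ :=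
  f X - f (toggle x X)

open Classical in
/-- The contribution of a site next to a dimer to the `weight` of the dimer: the reduction
`r / (2 (1 + r))` unless `p` holds, which says that the site is occupied. -/
noncomputable def vacancyCost (r : ℝ) (p : Prop) : ℝ := if p then 0 else r / (2 * (1 + r))

/-- The weight of the dimer on the block of `x` in the maximum principle for increments. On either
side it is reduced if the decay of the dimer leaves no second monomer with which to recombine. -/
noncomputable def weight (r : ℝ) (X : Config L) (x : Fin L) : ℝ :=
  1 - vacancyCost r (occ X x (-3)) - vacancyCost r (occ X x 6)

theorem rate_nonneg {r : ℝ} (hr : 0 ≤ r) (X : Config L) (x : Fin L) : 0 ≤ rate r X x := by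
  unfold rate
  split_ifs <;> positivity

theorem IsDimer.not_isPair {X : Config L} {x : Fin L} (h : IsDimer X x) : ¬IsPair X x :=
  fun h' => h.1 h'.1

theorem IsDimer.rate_eq_one (r : ℝ) {X : Config L} {x : Fin L} (h : IsDimer X x) :
    rate r X x = 1 :=
  if_pos h

theorem IsPair.rate_eq (r : ℝ) {X : Config L} {x : Fin L} (h : IsPair X x) : rate r X x = r := by
  rw [rate, if_neg (mt IsDimer.not_isPair (not_not.2 h)), if_pos h]

theorem rate_eq_zero (r : ℝ) {X : Config L} {x : Fin L} (h : ¬(IsDimer X x ∨ IsPair X x)) :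
    rate r X x = 0 := by
  rw [not_or] at h
  rw [rate, if_neg h.1, if_neg h.2]

theorem rate_toggle_of_disjoint (r : ℝ) {x y : Fin L} (h : Disjoint (block x) (block y))
    (X : Config L) : rate r (toggle x X) y = rate r X y := by
  simp only [rate, isDimer_toggle_of_disjoint h, isPair_toggle_of_disjoint h]

section Neighbourhood

variable {X : Config L} {x : Fin L}

theorem IsDimer.rate_site_eq_zero (hX : IsTiling X) (hx : IsDimer X x) (r : ℝ) {j : ℤ}
    (hj : -6 < j) (hj' : j < 6) (hj₀ : j ≠ 0) : rate r X (site x j) = 0 := by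
  refine rate_eq_zero r ?_
  rw [isDimer_site, isPair_site]
  exact DimerAt.not_dimerAt_or_pairAt hx (hX.avoidsAt x) hj hj' hj₀

theorem IsDimer.not_isDimer_toggle_site (hL : 20 ≤ L) (hX : IsTiling X) (hx : IsDimer X x) {j : ℤ}
    (hj : -4 < j) (hj' : j < 4) (hj₀ : j ≠ 0) : ¬IsDimer (toggle x X) (site x j) := by
  rw [isDimer_site]
  exact DimerAt.exchange_not_dimerAt hx (hX.avoidsAt x)
    (fun _ _ _ => occ_toggle x X (by omega) (by omega)) hj hj' hj₀

theorem IsDimer.isPair_toggle_site_iff (hL : 20 ≤ L) (hX : IsTiling X) (hx : IsDimer X x) {j : ℤ}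
    (hj : -4 < j) (hj' : j < 4) (hj₀ : j ≠ 0) :
    IsPair (toggle x X) (site x j) ↔ (j = 3 ∧ occ X x 6) ∨ (j = -3 ∧ occ X x (-3)) := by
  rw [isPair_site]
  exact DimerAt.exchange_pairAt_iff hx (hX.avoidsAt x)
    (fun _ _ _ => occ_toggle x X (by omega) (by omega)) hj hj' hj₀

theorem IsDimer.rate_toggle_site (hL : 20 ≤ L) (hX : IsTiling X) (hx : IsDimer X x) (r : ℝ)
    {j : ℤ} (hj : -4 < j) (hj' : j < 4) (hj₀ : j ≠ 0) :
    rate r (toggle x X) (site x j) =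
      if (j = 3 ∧ occ X x 6) ∨ (j = -3 ∧ occ X x (-3)) then r else 0 := by
  rw [rate, if_neg (hx.not_isDimer_toggle_site hL hX hj hj' hj₀)]
  simp only [hx.isPair_toggle_site_iff hL hX hj hj' hj₀]

theorem IsDimer.rate_site_six (hX : IsTiling X) (hx : IsDimer X x) (r : ℝ) (h₆ : occ X x 6) :
    rate r X (site x 6) = if occ X x 9 then r else 0 := by
  have hdimer : ¬IsDimer X (site x 6) := fun h => (isDimer_site X x 6).1 h |>.1 h₆
  rw [rate, if_neg hdimer]
  simp only [isPair_site, DimerAt.pairAt_six_iff hx (hX.avoidsAt x) h₆]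

theorem IsDimer.rate_site_neg_six (hX : IsTiling X) (hx : IsDimer X x) (r : ℝ)
    (h₃ : occ X x (-3)) : rate r X (site x (-6)) = if occ X x (-6) then r else 0 := by
  have hdimer : ¬IsDimer X (site x (-6)) := fun h => (isDimer_site X x (-6)).1 h |>.2.2.2 h₃
  rw [rate, if_neg hdimer]
  simp only [isPair_site, DimerAt.pairAt_neg_six_iff hx (hX.avoidsAt x) h₃]

theorem rate_site_le_one_of_not_occ (r : ℝ) {i : ℤ} (h : ¬occ X x i ∨ ¬occ X x (i + 3)) :
    rate r X (site x i) ≤ 1 := by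
  have hpair : ¬IsPair X (site x i) := fun hp =>
    have := (isPair_site X x i).1 hp
    h.elim (· this.1) (· this.2.2.2)
  rw [rate, if_neg hpair]
  split_ifs <;> norm_num

end Neighbourhood

theorem weight_pos {r : ℝ} (hr : 0 ≤ r) (X : Config L) (x : Fin L) : 0 < weight r X x := by
  have hinv : 1 - r / (2 * (1 + r)) - r / (2 * (1 + r)) = 1 / (1 + r) := by field_simp; ring
  have : 0 < 1 / (1 + r) := by positivity
  have : 0 ≤ r / (2 * (1 + r)) := by positivity
  unfold weight vacancyCost
  split_ifs <;> linarith

theorem weight_le_one {r : ℝ} (hr : 0 ≤ r) (X : Config L) (x : Fin L) : weight r X x ≤ 1 := by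
  have : 0 ≤ r / (2 * (1 + r)) := by positivity
  unfold weight vacancyCost
  split_ifs <;> linarith

theorem one_sided_drift_bound {r : ℝ} (hr : 0 ≤ r) {p q : Prop} [Decidable p] [Decidable q]
    {a : ℝ} (hp : p → a = if q then r else 0) (hp' : ¬p → a ≤ 1) :
    1 / 2 - r / (2 * (1 + r)) ≤ (1 + r) * (1 / 2 - vacancyCost r p) +
      a * (vacancyCost r (¬p) - vacancyCost r p) -
        (if p then r else 0) * (1 - vacancyCost r q) := by
  have hc : r / (2 * (1 + r)) * (1 + r) = r / 2 := by field_simp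
  have hc₀ : 0 ≤ r / (2 * (1 + r)) := by positivity
  set c := r / (2 * (1 + r)) with hcdef
  by_cases h : p
  · by_cases hq : q <;> simp only [vacancyCost, hp h, hq, not_true, if_true, if_false,
      h, ← hcdef] <;> linarith
  · simp only [vacancyCost, h, not_false_iff, if_true, if_false, ← hcdef]
    have := mul_le_mul_of_nonneg_right (hp' h) hc₀
    linarith

theorem sum_rate_mul_vacancyCost_sub (r : ℝ) {X : Config L} {x : Fin L} {s : Finset (Fin L)}
    {k j₀ : ℤ} (hs : site x j₀ ∈ s) (hj₀ : k - 4 < j₀ ∧ j₀ ≤ k)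
    (hzero : ∀ j, k - 4 < j → j ≤ k → j ≠ j₀ → rate r X (site x j) = 0) :
    ∑ y ∈ s, rate r X y * (vacancyCost r (occ (toggle y X) x k) - vacancyCost r (occ X x k)) =
      rate r X (site x j₀) * (vacancyCost r (¬occ X x k) - vacancyCost r (occ X x k)) := by
  have hocc : ∀ y, occ (toggle y X) x k ↔
      if site x k ∈ block y then ¬occ X x k else occ X x k :=
    fun y => toggle_apply_eq_one y _ X
  rw [Finset.sum_eq_single_of_mem _ hs fun y _ hy => ?_]
  · have : site x k ∈ block (site x j₀) :=
      mem_block.2 ⟨k - j₀, by omega, by rw [site_site, add_sub_cancel]⟩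
    simp only [hocc, if_pos this]
  · by_cases hk : site x k ∈ block y
    · obtain ⟨i, hi, hik⟩ := mem_block.1 hk
      have hy' : y = site x (k - i) := by
        rw [sub_eq_add_neg, ← site_site, ← hik, site_site, add_neg_cancel, site_zero]
      rw [hy', hzero (k - i) (by omega) (by omega) (by rintro rfl; exact hy hy'), zero_mul]
    · simp only [hocc, if_neg hk, sub_self, mul_zero]

/-- The dimer moves that act on the block of `x` and a second block meeting it. -/
noncomputable def overlapping (x : Fin L) : Finset (Fin L) :=
  Finset.univ.filter fun y => y ≠ x ∧ ¬Disjoint (block x) (block y)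

/-- The dimer moves that do not touch the block of `x`. -/
noncomputable def nonoverlapping (x : Fin L) : Finset (Fin L) :=
  Finset.univ.filter fun y => Disjoint (block x) (block y)

theorem mem_nonoverlapping {x y : Fin L} : y ∈ nonoverlapping x ↔ Disjoint (block x) (block y) := by
  simp [nonoverlapping]

theorem exists_eq_site_of_mem_overlapping {x y : Fin L} (h : y ∈ overlapping x) :
    ∃ j, (-4 < j ∧ j < 4 ∧ j ≠ 0) ∧ y = site x j := by
  simp only [overlapping, Finset.mem_filter, Finset.mem_univ, true_and] at h
  obtain ⟨j, hj, hj', rfl⟩ := exists_eq_site_of_not_disjoint_block h.2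
  exact ⟨j, ⟨hj, hj', by rintro rfl; exact h.1 (site_zero x)⟩, rfl⟩

theorem site_mem_overlapping (hL : 8 ≤ L) (x : Fin L) {j : ℤ} (hj : -4 < j) (hj' : j < 4)
    (hj₀ : j ≠ 0) : site x j ∈ overlapping x := by
  simp only [overlapping, Finset.mem_filter, Finset.mem_univ, true_and]
  refine ⟨fun h => hj₀ ((site_inj x (j := 0) (by rw [abs_lt]; omega)).1 (by rwa [site_zero])), ?_⟩
  rw [Finset.not_disjoint_iff]
  refine ⟨site x (max j 0), mem_block.2 ⟨_, by omega, rfl⟩,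
    mem_block.2 ⟨max j 0 - j, by omega, by rw [site_site, add_sub_cancel]⟩⟩

theorem site_mem_nonoverlapping (x : Fin L) {j : ℤ} (hj : 4 ≤ |j|) (hj' : |j| ≤ L - 4) :
    site x j ∈ nonoverlapping x := by
  rw [mem_nonoverlapping]
  by_contra h
  obtain ⟨i, hi, hi', hij⟩ := exists_eq_site_of_not_disjoint_block h
  rw [le_abs'] at hj
  rw [abs_le] at hj'
  have := (site_inj x (by rw [abs_lt]; omega)).1 hij
  omega

theorem sum_eq_self_add_nonoverlapping_add_overlapping (x : Fin L) (F : Fin L → ℂ) :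
    ∑ y, F y = F x + ∑ y ∈ nonoverlapping x, F y + ∑ y ∈ overlapping x, F y := by
  classical
  have hself : ¬Disjoint (block x) (block x) := by
    rw [disjoint_self]
    exact Finset.ne_empty_of_mem (mem_block.2 ⟨0, by omega, site_zero x⟩)
  have hoverlap : overlapping x =
      (Finset.univ.filter fun y => ¬Disjoint (block x) (block y)).erase x := by
    ext y
    simp [overlapping]
  rw [← Finset.sum_filter_add_sum_filter_not Finset.univ (fun y => Disjoint (block x) (block y)),
    hoverlap, nonoverlapping,
    ← Finset.add_sum_erase (Finset.univ.filter fun y => ¬Disjoint (block x) (block y)) F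
      (Finset.mem_filter.2 ⟨Finset.mem_univ x, hself⟩)]
  ring

theorem IsDimer.sum_nonoverlapping (hL : 20 ≤ L) {X : Config L} {x : Fin L} (hX : IsTiling X)
    (hx : IsDimer X x) (r : ℝ) :
    ∑ y ∈ nonoverlapping x, rate r X y * (weight r X x - weight r (toggle y X) x) =
      rate r X (site x (-6)) *
          (vacancyCost r (¬occ X x (-3)) - vacancyCost r (occ X x (-3))) +
        rate r X (site x 6) * (vacancyCost r (¬occ X x 6) - vacancyCost r (occ X x 6)) := by
  rw [← sum_rate_mul_vacancyCost_sub r (x := x) (s := nonoverlapping x) (k := -3)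
      (site_mem_nonoverlapping x (by norm_num) (by norm_num; omega)) (by norm_num)
      fun j _ _ _ => hx.rate_site_eq_zero hX r (by omega) (by omega) (by omega),
    ← sum_rate_mul_vacancyCost_sub r (x := x) (s := nonoverlapping x) (k := 6)
      (site_mem_nonoverlapping x (by norm_num) (by norm_num; omega)) (by norm_num)
      fun j _ _ _ => hx.rate_site_eq_zero hX r (by omega) (by omega) (by omega),
    ← Finset.sum_add_distrib]
  refine Finset.sum_congr rfl fun y _ => ?_
  rw [weight, weight]
  ring

theorem IsDimer.weight_after_exchange (hL : 20 ≤ L) {X : Config L} {x : Fin L}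
    (hx : IsDimer X x) (r : ℝ) :
    weight r (toggle (site x 3) (toggle x X)) (site x 3) = 1 - vacancyCost r (occ X x 9) ∧
      weight r (toggle (site x (-3)) (toggle x X)) (site x (-3)) =
        1 - vacancyCost r (occ X x (-6)) := by
  have hocc : ∀ i j : ℤ, i = 3 ∨ i = -3 → j = -3 ∨ j = 6 →
      (occ (toggle (site x i) (toggle x X)) (site x i) j ↔
        if 0 ≤ i + j ∧ i + j < 4 then ¬occ X x (i + j) else occ X x (i + j)) := fun i j hi hj => by
    rw [occ_toggle _ _ (by omega) (by omega), if_neg (by omega), occ_site,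
      occ_toggle _ _ (by omega) (by omega)]
  have h₀ : ¬occ X x 0 := hx.1
  have h₃ : ¬occ X x 3 := hx.2.2.2
  constructor <;>
    rw [weight, hocc _ _ (by norm_num) (by norm_num), hocc _ _ (by norm_num) (by norm_num)] <;>
    norm_num [h₀, h₃, vacancyCost]

theorem IsDimer.sum_overlapping (hL : 20 ≤ L) {X : Config L} {x : Fin L} (hX : IsTiling X)
    (hx : IsDimer X x) (r : ℝ) :
    ∑ y ∈ overlapping x, rate r (toggle x X) y * weight r (toggle y (toggle x X)) y =
      (if occ X x (-3) then r else 0) * (1 - vacancyCost r (occ X x (-6))) +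
        (if occ X x 6 then r else 0) * (1 - vacancyCost r (occ X x 9)) := by
  have hne : site x (-3) ≠ site x 3 := fun h => by
    rw [site_inj x (by norm_num; omega)] at h
    omega
  rw [Finset.sum_eq_add_of_mem _ _ (site_mem_overlapping (by omega) x (by norm_num) (by norm_num)
      (by norm_num)) (site_mem_overlapping (by omega) x (by norm_num) (by norm_num)
      (by norm_num)) hne fun y hy hyne => ?_,
    hx.rate_toggle_site hL hX r (by norm_num) (by norm_num) (by norm_num),
    hx.rate_toggle_site hL hX r (by norm_num) (by norm_num) (by norm_num),
    (hx.weight_after_exchange hL r).1, (hx.weight_after_exchange hL r).2]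
  · norm_num
  · obtain ⟨j, hj, rfl⟩ := exists_eq_site_of_mem_overlapping hy
    have hj₃ : j ≠ 3 ∧ j ≠ -3 := ⟨by rintro rfl; exact hyne.2 rfl, by rintro rfl; exact hyne.1 rfl⟩
    rw [hx.rate_toggle_site hL hX r hj.1 hj.2.1 hj.2.2, if_neg (by omega), zero_mul]

theorem IsDimer.inv_one_add_le_drift (hL : 20 ≤ L) {r : ℝ} (hr : 0 ≤ r) {X : Config L}
    {x : Fin L} (hX : IsTiling X) (hx : IsDimer X x) :
    1 / (1 + r) ≤ (1 + r) * weight r X x +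
      ∑ y ∈ nonoverlapping x, rate r X y * (weight r X x - weight r (toggle y X) x) -
        ∑ y ∈ overlapping x, rate r (toggle x X) y * weight r (toggle y (toggle x X)) y := by
  have hleft := one_sided_drift_bound hr (hx.rate_site_neg_six hX r) fun h =>
    rate_site_le_one_of_not_occ r (i := -6) (.inr (by simpa using h))
  have hright := one_sided_drift_bound hr (hx.rate_site_six hX r) fun h =>
    rate_site_le_one_of_not_occ r (.inl h)
  have hinv : 1 / (1 + r) = 1 / 2 - r / (2 * (1 + r)) + (1 / 2 - r / (2 * (1 + r))) := by
    field_simp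
    ring
  rw [hx.sum_nonoverlapping hL hX, hx.sum_overlapping hL hX, hinv, weight]
  linarith

theorem weighted_maximum_principle {ι : Type*} {s t : Finset ι} {p q u z : ι → ℝ}
    {G K : ι → ℂ} {g : ℂ} {a m w ν : ℝ} (hm : 0 < m) (hg : ‖g‖ = m * w)
    (hG : ∀ y ∈ s, ‖p y * G y‖ ≤ m * (p y * u y)) (hK : ∀ y ∈ t, ‖q y * K y‖ ≤ m * (q y * z y))
    (heq : ν * g = a * g + ∑ y ∈ s, p y * (g - G y) + ∑ y ∈ t, q y * K y) :
    a * w + ∑ y ∈ s, p y * (w - u y) - ∑ y ∈ t, q y * z y ≤ ν * w := by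
  have hsplit : ((a + ∑ y ∈ s, p y - ν : ℝ) : ℂ) * g = ∑ y ∈ s, p y * G y - ∑ y ∈ t, q y * K y := by
    push_cast
    simp only [mul_sub, Finset.sum_sub_distrib, ← Finset.sum_mul] at heq ⊢
    linear_combination -heq
  have hnorm : (a + ∑ y ∈ s, p y - ν) * (m * w) ≤
      m * (∑ y ∈ s, p y * u y + ∑ y ∈ t, q y * z y) :=
    calc (a + ∑ y ∈ s, p y - ν) * (m * w)
        ≤ |a + ∑ y ∈ s, p y - ν| * ‖g‖ := by
          rw [← hg]
          exact mul_le_mul_of_nonneg_right (le_abs_self _) (norm_nonneg g)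
      _ = ‖∑ y ∈ s, p y * G y - ∑ y ∈ t, q y * K y‖ := by
        rw [← hsplit, norm_mul, Complex.norm_real, Real.norm_eq_abs]
      _ ≤ ∑ y ∈ s, m * (p y * u y) + ∑ y ∈ t, m * (q y * z y) :=
        (norm_sub_le _ _).trans (add_le_add (norm_sum_le_of_le _ hG) (norm_sum_le_of_le _ hK))
      _ = m * (∑ y ∈ s, p y * u y + ∑ y ∈ t, q y * z y) := by
        rw [mul_add, Finset.mul_sum, Finset.mul_sum]
  rw [mul_left_comm] at hnorm
  have hcancel := le_of_mul_le_mul_left hnorm hm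
  simp only [mul_sub, Finset.sum_sub_distrib, ← Finset.sum_mul]
  linarith

theorem IsDimer.eigenvalue_mul_increment (hL : 4 ≤ L) {r : ℝ} {f : Config L → ℂ} {ν : ℝ}
    {X : Config L} {x : Fin L} (hX : ν * f X = generator r f X)
    (hY : ν * f (toggle x X) = generator r f (toggle x X)) (hx : IsDimer X x)
    (hzero : ∀ y ∈ overlapping x, rate r X y = 0) :
    ν * increment f X x = (1 + r : ℝ) * increment f X x +
      ∑ y ∈ nonoverlapping x, rate r X y * (increment f X x - increment f (toggle y X) x) +
        ∑ y ∈ overlapping x,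
          rate r (toggle x X) y * increment f (toggle y (toggle x X)) y := by
  have hpair : IsPair (toggle x X) x := (isPair_toggle_iff hL X x).2 hx
  rw [increment, mul_sub, hX, hY, generator, generator, ← Finset.sum_sub_distrib,
    sum_eq_self_add_nonoverlapping_add_overlapping x, hx.rate_eq_one, hpair.rate_eq,
    toggle_toggle]
  congr 1
  · congr 1
    · push_cast
      ring
    · refine Finset.sum_congr rfl fun y hy => ?_
      rw [rate_toggle_of_disjoint r (mem_nonoverlapping.1 hy), increment, toggle_comm y x]
      ring
  · refine Finset.sum_congr rfl fun y hy => ?_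
    rw [hzero y hy, increment, toggle_toggle]
    push_cast
    ring

theorem IsTiling.toggle_of_rate_ne_zero (hL : 20 ≤ L) {r : ℝ} {X : Config L} {x : Fin L}
    (hX : IsTiling X) (h : rate r X x ≠ 0) : IsTiling (toggle x X) :=
  hX.isTiling_toggle hL (not_not.1 (mt (rate_eq_zero r) h))

theorem IsDimer.isTiling_toggle_overlapping (hL : 20 ≤ L) {r : ℝ} {X : Config L} {x y : Fin L}
    (hX : IsTiling X) (hx : IsDimer X x) (hy : y ∈ overlapping x) (h : rate r (toggle x X) y ≠ 0) :
    IsTiling (toggle y (toggle x X)) ∧ IsDimer (toggle y (toggle x X)) y := by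
  have hmove := not_not.1 (mt (rate_eq_zero r) h)
  refine ⟨(hX.isTiling_toggle hL (.inl hx)).isTiling_toggle hL hmove, ?_⟩
  rw [isDimer_toggle_iff (by omega)]
  obtain ⟨j, hj, rfl⟩ := exists_eq_site_of_mem_overlapping hy
  exact hmove.resolve_left (hx.not_isDimer_toggle_site hL hX hj.1 hj.2.1 hj.2.2)

theorem norm_ofReal_mul_le {p m c : ℝ} {z : ℂ} (hp : 0 ≤ p) (hz : p ≠ 0 → ‖z‖ ≤ m * c) :
    ‖(p : ℂ) * z‖ ≤ m * (p * c) := by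
  rcases eq_or_ne p 0 with rfl | hp₀
  · simp
  · rw [norm_mul, Complex.norm_real, Real.norm_of_nonneg hp, mul_left_comm]
    exact mul_le_mul_of_nonneg_left (hz hp₀) hp

theorem inv_one_add_le_of_isMax (hL : 20 ≤ L) {r : ℝ} (hr : 0 ≤ r) {f : Config L → ℂ} {ν : ℝ}
    (hf : ∀ X, IsTiling X → ν * f X = generator r f X) {m : ℝ} (hm : 0 < m)
    (hmax : ∀ X x, IsTiling X → IsDimer X x → ‖increment f X x‖ ≤ m * weight r X x)
    {X : Config L} {x : Fin L} (hX : IsTiling X) (hx : IsDimer X x)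
    (heq : ‖increment f X x‖ = m * weight r X x) : 1 / (1 + r) ≤ ν := by
  have hbound := weighted_maximum_principle (s := nonoverlapping x) (t := overlapping x)
    (p := rate r X) (q := rate r (toggle x X)) (u := fun y => weight r (toggle y X) x)
    (z := fun y => weight r (toggle y (toggle x X)) y) hm heq
    (fun y hy => norm_ofReal_mul_le (rate_nonneg hr X y) fun h =>
      hmax _ x (hX.toggle_of_rate_ne_zero hL h)
        ((isDimer_toggle_of_disjoint (mem_nonoverlapping.1 hy).symm X).2 hx))
    (fun y hy => norm_ofReal_mul_le (rate_nonneg hr _ y) fun h =>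
      have hU := hx.isTiling_toggle_overlapping hL hX hy h
      hmax _ y hU.1 hU.2)
    (hx.eigenvalue_mul_increment (by omega) (hf X hX)
      (hf _ (hX.isTiling_toggle hL (.inl hx))) fun y hy => by
        obtain ⟨j, hj, rfl⟩ := exists_eq_site_of_mem_overlapping hy
        exact hx.rate_site_eq_zero hX r (by omega) (by omega) hj.2.2)
  have hdrift : 1 / (1 + r) ≤ ν * weight r X x := (hx.inv_one_add_le_drift hL hr hX).trans hbound
  have hν : 0 ≤ ν := nonneg_of_mul_nonneg_left (le_trans (by positivity) hdrift) (weight_pos hr X x)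
  exact hdrift.trans (mul_le_of_le_one_right hν (weight_le_one hr X x))

theorem generator_eq_zero_of_increment_eq_zero (hL : 20 ≤ L) (r : ℝ) {f : Config L → ℂ}
    (hzero : ∀ X x, IsTiling X → IsDimer X x → increment f X x = 0) {X : Config L}
    (hX : IsTiling X) : generator r f X = 0 := by
  refine Finset.sum_eq_zero fun y _ => ?_
  by_cases hdimer : IsDimer X y
  · exact mul_eq_zero_of_right _ (hzero X y hX hdimer)
  by_cases hpair : IsPair X y
  · have h := hzero _ y (hX.isTiling_toggle hL (.inr hpair))
      ((isDimer_toggle_iff (by omega) X y).2 hpair)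
    rw [increment, toggle_toggle, sub_eq_zero] at h
    rw [h, sub_self, mul_zero]
  · rw [rate_eq_zero r (not_or.2 ⟨hdimer, hpair⟩), Complex.ofReal_zero, zero_mul]

theorem eq_zero_or_inv_one_add_le (hL : 20 ≤ L) {r : ℝ} (hr : 0 ≤ r) {f : Config L → ℂ} {ν : ℝ}
    (hf : ∀ X, IsTiling X → ν * f X = generator r f X) :
    (∀ X, IsTiling X → f X = 0) ∨ ν = 0 ∨ 1 / (1 + r) ≤ ν := by
  classical
  by_cases hzero : ∀ X x, IsTiling X → IsDimer X x → increment f X x = 0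
  · rcases eq_or_ne ν 0 with hν | hν
    · exact .inr (.inl hν)
    · refine .inl fun X hX => ?_
      have h := (hf X hX).trans (generator_eq_zero_of_increment_eq_zero hL r hzero hX)
      exact (mul_eq_zero.1 h).resolve_left (by exact_mod_cast hν)
  push Not at hzero
  obtain ⟨X₀, x₀, hX₀, hx₀, hne⟩ := hzero
  have hmem : ∀ X x, IsTiling X → IsDimer X x → (X, x) ∈
      (Finset.univ.filter fun p : Config L × Fin L => IsTiling p.1 ∧ IsDimer p.1 p.2) :=
    fun X x hX hx => Finset.mem_filter.2 ⟨Finset.mem_univ _, hX, hx⟩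
  obtain ⟨⟨X, x⟩, hXx, hmax⟩ := Finset.exists_max_image _
    (fun p => ‖increment f p.1 p.2‖ / weight r p.1 p.2) ⟨_, hmem X₀ x₀ hX₀ hx₀⟩
  obtain ⟨hX, hx⟩ := (Finset.mem_filter.1 hXx).2
  have hpos : 0 < ‖increment f X x‖ / weight r X x :=
    lt_of_lt_of_le (div_pos (norm_pos_iff.2 hne) (weight_pos hr X₀ x₀))
      (hmax _ (hmem X₀ x₀ hX₀ hx₀))
  exact .inr (.inr (inv_one_add_le_of_isMax hL hr hf hpos
    (fun X' x' hX' hx' => (div_le_iff₀ (weight_pos hr X' x')).1 (hmax _ (hmem X' x' hX' hx')))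
    hX hx (div_mul_cancel₀ _ (weight_pos hr X x).ne').symm))

end Generator

section Conjugation

variable {L : ℕ}

/-- The number of dimers of a configuration. -/
def dimerCount (X : Config L) : ℕ := (Finset.univ.filter fun x => IsDimer X x).card

theorem IsDimer.dimerCount_eq (hL : 20 ≤ L) {X : Config L} {x : Fin L} (hX : IsTiling X)
    (hx : IsDimer X x) : dimerCount X = dimerCount (toggle x X) + 1 := by
  have herase : (Finset.univ.filter fun y => IsDimer (toggle x X) y) =
      (Finset.univ.filter fun y => IsDimer X y).erase x := by
    ext y
    simp only [Finset.mem_filter, Finset.mem_univ, true_and, Finset.mem_erase]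
    by_cases hdisj : Disjoint (block x) (block y)
    · rw [isDimer_toggle_of_disjoint hdisj]
      refine (and_iff_right_of_imp ?_).symm
      rintro - rfl
      exact Finset.disjoint_left.1 hdisj (mem_block.2 ⟨0, by omega, site_zero y⟩)
        (mem_block.2 ⟨0, by omega, site_zero y⟩)
    obtain ⟨j, hj, hj', rfl⟩ := exists_eq_site_of_not_disjoint_block hdisj
    rcases eq_or_ne j 0 with rfl | hj₀
    · rw [site_zero, isDimer_toggle_iff (by omega)]
      simpa using hx.not_isPair
    · refine iff_of_false (hx.not_isDimer_toggle_site hL hX hj hj' hj₀) fun h => ?_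
      exact DimerAt.not_dimerAt_or_pairAt hx (hX.avoidsAt x) (by omega) (by omega) hj₀
        (.inl ((isDimer_site X x j).1 h.2))
  rw [dimerCount, dimerCount, herase, Finset.card_erase_add_one (by simpa using hx)]

theorem IsTiling.periodicHamiltonian_mulVec_div (hL : 20 ≤ L) (κ : ℝ) {lam : ℂ} (hlam : lam ≠ 0)
    (v : Config L → ℂ) {X : Config L} (hX : IsTiling X) :
    (periodicHamiltonian L κ lam).mulVec v X / lam ^ dimerCount X =
      κ * generator (‖lam‖ ^ 2) (fun Z => v Z / lam ^ dimerCount Z) X := by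
  rw [hX.periodicHamiltonian_mulVec (by omega), mul_div_assoc, Finset.sum_div, generator]
  congr 1
  refine Finset.sum_congr rfl fun y _ => ?_
  by_cases hdimer : IsDimer X y
  · have := pow_ne_zero (dimerCount (toggle y X)) hlam
    rw [if_pos hdimer, if_neg hdimer.not_isPair, hdimer.rate_eq_one, hdimer.dimerCount_eq hL hX]
    field_simp
    push_cast
    ring
  by_cases hpair : IsPair X y
  · have hcount := IsDimer.dimerCount_eq hL (hX.isTiling_toggle hL (.inr hpair))
      ((isDimer_toggle_iff (by omega) X y).2 hpair)
    rw [toggle_toggle] at hcount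
    have hnorm : ((‖lam‖ ^ 2 : ℝ) : ℂ) = star lam * lam := by
      rw [RCLike.star_def, Complex.conj_mul', Complex.ofReal_pow]
    have := pow_ne_zero (dimerCount X) hlam
    rw [if_neg hdimer, if_pos hpair, hpair.rate_eq, hcount, hnorm]
    field_simp
    ring
  · simp [hdimer, hpair, rate_eq_zero]

theorem eigenvalue_of_tilings (hL : 20 ≤ L) {κ : ℝ} (hκ : 0 < κ) {lam : ℂ} (hlam : lam ≠ 0)
    {v : Config L → ℂ} {μ : ℝ} (hv : (periodicHamiltonian L κ lam).mulVec v = (μ : ℂ) • v) :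
    (∀ X, IsTiling X → v X = 0) ∨ μ = 0 ∨ κ / (1 + ‖lam‖ ^ 2) ≤ μ := by
  have hgen : ∀ X : Config L, IsTiling X → ((μ / κ : ℝ) : ℂ) * (v X / lam ^ dimerCount X) =
      generator (‖lam‖ ^ 2) (fun Z => v Z / lam ^ dimerCount Z) X := fun X hX => by
    have h := hX.periodicHamiltonian_mulVec_div hL κ hlam v
    have : (κ : ℂ) ≠ 0 := by exact_mod_cast hκ.ne'
    rw [hv, Pi.smul_apply, smul_eq_mul] at h
    push_cast
    field_simp at h ⊢
    exact h
  rcases eq_zero_or_inv_one_add_le hL (sq_nonneg ‖lam‖) hgen with h | h | h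
  · exact .inl fun X hX => (div_eq_zero_iff.1 (h X hX)).resolve_right (pow_ne_zero _ hlam)
  · exact .inr (.inl ((div_eq_zero_iff.1 h).resolve_right hκ.ne'))
  · rw [le_div_iff₀ hκ, div_mul_eq_mul_div, one_mul] at h
    exact .inr (.inr h)

end Conjugation

section Spectrum

theorem exists_eigenvector_of_mem_spectrum {ι : Type*} [Fintype ι] [DecidableEq ι]
    {H : Matrix ι ι ℂ} {μ : ℝ} (h : μ ∈ spectrum ℝ H) :
    ∃ v : ι → ℂ, v ≠ 0 ∧ H.mulVec v = (μ : ℂ) • v := by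
  rw [spectrum.mem_iff, Matrix.isUnit_iff_isUnit_det, isUnit_iff_ne_zero, not_not] at h
  obtain ⟨v, hv, hv'⟩ := Matrix.exists_mulVec_eq_zero_iff.2 h
  refine ⟨v, hv, ?_⟩
  rw [Matrix.sub_mulVec, sub_eq_zero, Algebra.algebraMap_eq_smul_one, Matrix.smul_mulVec,
    Matrix.one_mulVec] at hv'
  rw [← hv', Complex.coe_smul]

theorem exists_ne_zero_mem_spectrum {ι : Type*} [Fintype ι] [DecidableEq ι]
    {H : Matrix ι ι ℂ} (hH : H.IsHermitian) (h₀ : H ≠ 0) : ∃ μ ∈ spectrum ℝ H, μ ≠ 0 := by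
  by_contra! h
  exact h₀ (hH.eigenvalues_eq_zero_iff.1 (funext fun i => h _ (hH.eigenvalues_mem_spectrum_real i)))

theorem spectralGap_nonneg {ι : Type*} [Fintype ι] [DecidableEq ι] (H : Matrix ι ι ℂ) :
    0 ≤ spectralGap H :=
  Real.sInf_nonneg fun _ hδ => hδ.1.le

variable {L : ℕ}

theorem eq_zero_or_le_of_mem_spectrum (hL : 20 ≤ L) {κ : ℝ} (hκ : 0 < κ) {lam : ℂ}
    (hlam : lam ≠ 0) {μ : ℝ} (h : μ ∈ spectrum ℝ (periodicHamiltonian L κ lam)) :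
    μ = 0 ∨ min (1 / (2 + 4 / κ + 2 * ‖lam‖ ^ 2)) (κ / (1 + ‖lam‖ ^ 2)) ≤ μ := by
  obtain ⟨v, hv₀, hv⟩ := exists_eigenvector_of_mem_spectrum h
  have hcompl := mulVec_indicator_compl (isHermitian_periodicHamiltonian κ lam)
    (S := {X | IsTiling X}) (fun _ hX _ hZ => periodicHamiltonian_apply_eq_zero hL κ lam hX hZ) hv
  by_cases hoff : ({X | IsTiling X}ᶜ : Set (Config L)).indicator v = 0
  · rcases eigenvalue_of_tilings hL hκ hlam hv with hzero | hμ | hμ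
    · refine absurd (funext fun X => ?_) hv₀
      by_cases hX : IsTiling X
      · exact hzero X hX
      · exact (Set.indicator_of_mem hX v).symm.trans (congrFun hoff X)
    · exact .inl hμ
    · exact .inr (min_le_of_right_le hμ)
  · exact .inr (min_le_of_left_le (inv_le_eigenvalue_of_eq_zero_of_isTiling hL hκ lam hcompl hoff
      fun X hX => Set.indicator_of_notMem (not_not.2 hX) v))

theorem zero_mem_spectrum_periodicHamiltonian (hL : 4 ≤ L) (κ : ℝ) (lam : ℂ) :
    (0 : ℝ) ∈ spectrum ℝ (periodicHamiltonian L κ lam) := by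
  have hvacuum : IsTiling (0 : Config L) := fun x => by simp [AvoidsAt, occ]
  rw [spectrum.zero_mem_iff, Matrix.isUnit_iff_isUnit_det, isUnit_iff_ne_zero, not_not]
  refine Matrix.det_eq_zero_of_row_eq_zero 0 fun Z => ?_
  have h := hvacuum.periodicHamiltonian_mulVec hL κ lam (Pi.single Z 1)
  rw [Matrix.mulVec_single_one] at h
  refine h.trans (mul_eq_zero_of_right _ (Finset.sum_eq_zero fun x _ => ?_))
  simp [IsDimer, DimerAt, IsPair, PairAt, occ]

theorem periodicHamiltonian_ne_zero (hL : 0 < L) {κ : ℝ} (hκ : 0 ≤ κ) (lam : ℂ) :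
    periodicHamiltonian L κ lam ≠ 0 := by
  intro hzero
  set v : Config L → ℂ := Pi.single (fun _ => 1) 1 with hv
  have h := star_dotProduct_periodicHamiltonian κ lam v
  rw [hzero, Matrix.zero_mulVec, dotProduct_zero] at h
  have henergy : 0 = electrostaticEnergy v + κ * ∑ x, ∑ Z, ‖(dipole lam x).mulVec v Z‖ ^ 2 := by
    exact_mod_cast h
  have hdipole : 0 ≤ κ * ∑ x, ∑ Z, ‖(dipole lam x).mulVec v Z‖ ^ 2 := by positivity
  have hpos : 0 < electrostaticEnergy v := by
    refine Finset.sum_pos' (fun _ _ => by positivity) ⟨(⟨0, hL⟩, fun _ => 1), ?_, ?_⟩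
    · simp [occ]
    · simp [hv]
  linarith

theorem le_spectralGap_periodicHamiltonian (hL : 20 ≤ L) {κ : ℝ} (hκ : 0 < κ) {lam : ℂ}
    (hlam : lam ≠ 0) :
    min (1 / (2 + 4 / κ + 2 * ‖lam‖ ^ 2)) (κ / (1 + ‖lam‖ ^ 2)) ≤
      spectralGap (periodicHamiltonian L κ lam) := by
  have hpos : 0 < min (1 / (2 + 4 / κ + 2 * ‖lam‖ ^ 2)) (κ / (1 + ‖lam‖ ^ 2)) := by positivity
  have hnonneg : ∀ μ ∈ spectrum ℝ (periodicHamiltonian L κ lam), 0 ≤ μ := fun μ hμ =>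
    (eq_zero_or_le_of_mem_spectrum hL hκ hlam hμ).elim Eq.ge hpos.le.trans
  have hground : groundEnergy (periodicHamiltonian L κ lam) = 0 :=
    IsLeast.csInf_eq ⟨zero_mem_spectrum_periodicHamiltonian (by omega) κ lam, hnonneg⟩
  simp only [spectralGap, hground, zero_add]
  refine le_csInf ?_ fun δ hδ =>
    (eq_zero_or_le_of_mem_spectrum hL hκ hlam hδ.2).resolve_left hδ.1.ne'
  obtain ⟨μ, hμ, hne⟩ := exists_ne_zero_mem_spectrum (isHermitian_periodicHamiltonian κ lam)
    (periodicHamiltonian_ne_zero (L := L) (by omega) hκ.le lam)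
  exact ⟨μ, (hnonneg μ hμ).lt_of_ne' hne, hμ⟩

end Spectrum

section GapBound

theorem gammaPer_le {κ : ℝ} (hκ : 0 < κ) (lam : ℂ) :
    gammaPer κ lam ≤ 1 / (2 + 4 / κ + 2 * ‖lam‖ ^ 2) := by
  have hdimer : gammaPer κ lam ≤ 1 / 3 * (κ / (2 + 2 * κ * ‖lam‖ ^ 2)) :=
    mul_le_mul_of_nonneg_left ((min_le_right _ _).trans (min_le_left _ _)) (by norm_num)
  have hmonomer : gammaPer κ lam ≤ 1 / 3 * (κ / (1 + κ)) :=
    mul_le_mul_of_nonneg_left ((min_le_right _ _).trans (min_le_right _ _)) (by norm_num)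
  rw [le_div_iff₀ (by positivity)]
  calc gammaPer κ lam * (2 + 4 / κ + 2 * ‖lam‖ ^ 2)
      = gammaPer κ lam * (2 / κ + 2 * ‖lam‖ ^ 2) + 2 * (gammaPer κ lam * (1 / κ + 1)) := by ring
    _ ≤ 1 / 3 * (κ / (2 + 2 * κ * ‖lam‖ ^ 2)) * (2 / κ + 2 * ‖lam‖ ^ 2) +
          2 * (1 / 3 * (κ / (1 + κ)) * (1 / κ + 1)) := by gcongr
    _ = 1 := by field_simp; norm_num

theorem gapBound_le {κ : ℝ} (hκ : 0 < κ) (lam : ℂ) {v : ℝ} (hv : v ≤ 1) :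
    gapBound κ lam v ≤ min (1 / (2 + 4 / κ + 2 * ‖lam‖ ^ 2)) (κ / (1 + ‖lam‖ ^ 2)) := by
  refine min_le_min (gammaPer_le hκ lam) ?_
  have hsqrt : √(3 * v) ≤ 2 := Real.sqrt_le_iff.2 ⟨by norm_num, by linarith⟩
  have hfactor : (1 - √(3 * v)) ^ 2 ≤ 1 := by
    rw [sq_le_one_iff_abs_le_one, abs_le]
    constructor <;> linarith [Real.sqrt_nonneg (3 * v)]
  calc κ / (6 * (1 + 2 * ‖lam‖ ^ 2)) * (1 - √(3 * v)) ^ 2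
      ≤ κ / (6 * (1 + 2 * ‖lam‖ ^ 2)) := mul_le_of_le_one_right (by positivity) hfactor
    _ ≤ κ / (1 + ‖lam‖ ^ 2) :=
      div_le_div_of_nonneg_left hκ.le (by positivity) (by linarith [sq_nonneg ‖lam‖])

theorem gapBound_zero_le (lam : ℂ) (v : ℝ) : gapBound 0 lam v ≤ 0 :=
  (min_le_right _ _).trans (by simp)

theorem gapBound_le_spectralGap {L : ℕ} (hL : 20 ≤ L) {κ : ℝ} (hκ : 0 ≤ κ) {lam : ℂ}
    (hlam : lam ≠ 0) {v : ℝ} (hv : v ≤ 1) :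
    gapBound κ lam v ≤ spectralGap (periodicHamiltonian L κ lam) := by
  rcases hκ.eq_or_lt with rfl | hκ
  · exact (gapBound_zero_le lam v).trans (spectralGap_nonneg _)
  · exact (gapBound_le hκ lam hv).trans (le_spectralGap_periodicHamiltonian hL hκ hlam)

end GapBound

end Haldane

theorem theorem1p1_general :
    ∃ f : ℝ≥0 → ℝ≥0,
      (∀ r : ℝ≥0, IsLUB {y : ℝ | ∃ k : ℕ, 4 ≤ k ∧ y = Haldane.fSeq k r} (f r)) ∧
      Monotone f ∧
      (∀ (lam : ℂ) (κ : ℝ), lam ≠ 0 → 0 ≤ κ → ∀ L ≥ 20,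
        Haldane.gapBound κ lam (f (‖lam‖₊ ^ 2)) ≤
          Haldane.spectralGap (Haldane.periodicHamiltonian L κ lam)) ∧
      (∀ᶠ lam : ℂ in 𝓝[≠] 0, (f (‖lam‖₊ ^ 2) : ℝ) < 1 / 3) ∧
      (∀ κ : ℝ, 0 < κ →
        0 < min 1 (min (κ / 2) (κ / (1 + κ))) / 3 ∧
        Filter.Tendsto (fun lam : ℂ => Haldane.gapBound κ lam (f (‖lam‖₊ ^ 2))) (𝓝[≠] 0)
          (𝓝 (min 1 (min (κ / 2) (κ / (1 + κ))) / 3))) :=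
  ⟨Haldane.fSup, Haldane.isLUB_fSup, Haldane.monotone_fSup,
    fun _ _ hlam hκ _ hL => Haldane.gapBound_le_spectralGap hL hκ hlam (Haldane.fSup_le_one _),
    Haldane.tendsto_fSup.eventually_lt_const (by norm_num),
    fun _ hκ => ⟨by positivity, Haldane.tendsto_gapBound hκ⟩⟩

theorem theorem1p1 :
    ∃ f : ℝ≥0 → ℝ≥0,
      -- `f` is the supremum of the explicit functions `f_k`, `k ≥ 4`, and is monotone increasing
      (∀ r : ℝ≥0, IsLUB {y : ℝ | ∃ k : ℕ, 4 ≤ k ∧ y = Haldane.fSeq k r} (f r)) ∧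
      Monotone f ∧
      -- the uniform lower bound on the bulk gap
      (∀ (lam : ℂ) (κ : ℝ), lam ≠ 0 → (f (‖lam‖₊ ^ 2) : ℝ) < 1 / 3 → 0 ≤ κ →
        ((Haldane.gapBound κ lam (f (‖lam‖₊ ^ 2)) : ℝ) : EReal) ≤
          Filter.liminf
            (fun L : ℕ =>
              ((Haldane.spectralGap (Haldane.periodicHamiltonian L κ lam) : ℝ) : EReal))
            Filter.atTop) ∧
      -- the bound applies to all small `lam ≠ 0` and stays positive as `lam → 0`
      (∀ᶠ lam : ℂ in 𝓝[≠] 0, (f (‖lam‖₊ ^ 2) : ℝ) < 1 / 3) ∧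
      (∀ κ : ℝ, 0 < κ →
        0 < min 1 (min (κ / 2) (κ / (1 + κ))) / 3 ∧
        Filter.Tendsto (fun lam : ℂ => Haldane.gapBound κ lam (f (‖lam‖₊ ^ 2))) (𝓝[≠] 0)
          (𝓝 (min 1 (min (κ / 2) (κ / (1 + κ))) / 3))) := by
  obtain ⟨f, hlub, hmono, hgap, hsmall, hlim⟩ := theorem1p1_general
  refine ⟨f, hlub, hmono, fun lam κ hlam _ hκ => ?_, hsmall, hlim⟩
  refine Filter.le_liminf_of_le (by isBoundedDefault) ?_
  filter_upwards [Filter.eventually_ge_atTop 20] with L hL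
  exact EReal.coe_le_coe_iff.2 (hgap lam κ hlam hκ L hL)
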